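/- **Setting.** Let $\mathbb S^{d-1}$ be the unit sphere of $\mathbb R^d$, $B(q,r)=\{x\in\mathbb S^{d-1}:\langle q,x\rangle\ge r\}$, and for $0\le\beta<\alpha<1$ let $$\rho=\rho(\alpha,\beta)=\frac{(1-\alpha^2)(1-\beta^2)}{(1-\alpha\beta)^2}.$$ A dataset $S$ is a finite multiset of points of $\mathbb S^{d-1}$; $|S\cap B(q,r)|$ is counted with multiplicity. Two datasets are neighbouring if one arises from the other by adding one point. A randomized algorithm $M$ is $(\varepsilon,\delta)$-differentially private if $\Pr[M(S)\in Y]\le e^{\varepsilon}\Pr[M(S')\in Y]+\delta$ for all neighbouring $S,S'$ and all measurable $Y$. Let $A=\frac1\varepsilon\log\bigl(1+\frac{e^\varepsilon-1}{2\delta}\bigr)$, and let $\mathrm{TLap}(1,\varepsilon,\delta)$ be the probability distribution on $[-A,A]$ with density proportional to $e^{-\varepsilon|x|}$. **The DPTop-1 data structure.** CONSTRUCTION, for a public size parameter $n$, sets $$m=\Bigl\lceil n^{(1-\beta^2)/(1-\alpha\beta)^2}\Bigr\rceil,\qquad \eta=\alpha\sqrt{2\log m}-\sqrt{2(1-\alpha^2)\log\log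 m},$$ draws independent standard Gaussian vectors $a_1,\dots,a_m\in\mathbb R^d$, and lets $T[i]$ be the number of points $x\in S$ with $i=\arg\max_{j\in[m]}\langle a_j,x\rangle$ (the first such index in case of ties). It then adds an independent $\mathrm{TLap}(1,\varepsilon,\delta)$ variable to each $T[i]$, replaces every resulting $T[i]\le A$ by $0$, and returns $\mathcal D=(T,(a_i)_i,m,\eta)$. QUERY$(q)$ returns $\widetilde{\mathrm{ans}}=\sum_{i:\langle a_i,q\rangle\ge\eta}T[i]$. **Theorem.** 1. *Privacy.* For all $d,n$, all $0\le\beta<\alpha<1$, $\varepsilon>0$ and $\delta\in(0,\frac12)$, CONSTRUCTION with size parameter $n$ is $(\varepsilon,\delta)$-differentially private. 2. *Accuracy.* Let $0\le\beta_n<\alpha_n<1$ be sequences (for example constant ones) such that, as $n\to\infty$, $$\alpha_n-\beta_n=\omega\Bigl((1-\alpha_n^2)\sqrt{\tfrac{\log\log n}{\log n}}\Bigr)\quad\text{and}\quad 1-\alpha_n^2=\omega\Bigl(\tfrac{\log\log m_n}{\log m_n}\Bigr),$$ where $m_n$ is the number $m$ for $n,\alpha_n,\beta_n$; put $\rho_n=\rho(\alpha_n,\beta_n)$.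 Then there are sequences $e_1(n),e_2(n)\to0$ such that for every $\varepsilon_0>0$ there is a constant $C>0$ with the following property for all sufficiently large $n$: for all $d$, $\varepsilon\in(0,\varepsilon_0]$, $\delta\in(0,\frac12)$, all $S$ with $|S|=n$ and all $q\in\mathbb S^{d-1}$, with probability at least $2/3$, $$(1-e_1(n))\,|S\cap B(q,\alpha_n)|-C\,\frac{\log(1/\delta)}{\varepsilon}\,n^{\rho_n+e_2(n)}\le\widetilde{\mathrm{ans}}\le|S\cap B(q,\beta_n)|+C\,\frac{\log(1/\delta)}{\varepsilon}\,n^{\rho_n+e_2(n)}.$$ 3. *Complexity.* On a real RAM with unit-cost instructions (real arithmetic, $\exp$, $\log$, square root, ceiling, integer arithmetic, comparisons, memory access, and drawing one $N(0,1)$ or one $\mathrm{TLap}(1,\varepsilon,\delta)$ variable), there are fixed programs for CONSTRUCTION and QUERY and an absolute constant $C$ such that for all $d,n\ge1$, $0\le\beta<\alpha<1$, $\varepsilon>0$, $\delta\in(0,\frac12)$, every dataset of $n$ points and every outcome of the draws, CONSTRUCTION takes at most $C\,d\,n^{1+\rho/(1-\alpha^2)}$ steps, every query takes at most $C\,d\,n^{\rho/(1-\alpha^2)}$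 steps, and both run in $C\,d\,n^{\rho/(1-\alpha^2)}$ words of memory, in which the data structure is stored. -/

import Mathlib

open Filter Topology MeasureTheory ProbabilityTheory Asymptotics
open scoped ENNReal NNReal RealInnerProductSpace

noncomputable section

namespace DPTopOne

/-! ### The unit sphere, datasets and balls -/

/-- Euclidean space of dimension `d`. -/
abbrev Vec (d : ℕ) : Type := EuclideanSpace ℝ (Fin d)

/-- The unit sphere of `d`-dimensional Euclidean space. -/
abbrev Sph (d : ℕ) : Type := Metric.sphere (0 : Vec d) 1

open Classical in
/-- `|S ∩ B(q, r)|` where `B(q, r) = {x | ⟪q, x⟫ ≥ r}`: the number of points of the dataset `S`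
(counted with multiplicity) whose inner product with `q` is at least `r`. -/
def ballCount {d : ℕ} (S : Multiset (Sph d)) (q : Sph d) (r : ℝ) : ℕ :=
  (S.filter fun x => r ≤ ⟪(q : Vec d), (x : Vec d)⟫).card

/-! ### Differential privacy -/

/-- Two datasets are neighbouring (addition/removal) if one of them is obtained from the other by
adding one point. -/
def Neighbouring {X : Type*} (S S' : Multiset X) : Prop :=
  ∃ x, S' = x ::ₘ S ∨ S = x ::ₘ S'

/-- `(ε, δ)`-differential privacy of a randomized algorithm, given by its output law `M S` on every
dataset `S`. -/
def IsDP {X O : Type*} [MeasurableSpace O] (ε δ : ℝ) (M : Multiset X → Measure O) : Prop :=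
  ∀ S S' : Multiset X, Neighbouring S S' → ∀ Y : Set O, MeasurableSet Y →
    M S Y ≤ ENNReal.ofReal (Real.exp ε) * M S' Y + ENNReal.ofReal δ

/-- The truncation radius of the truncated Laplace distribution with sensitivity `Δ`. -/
def tlapRadius (Δ ε δ : ℝ) : ℝ := Δ / ε * Real.log (1 + (Real.exp ε - 1) / (2 * δ))

/-- The unnormalized truncated Laplace distribution: density `exp (-|x| ε / Δ)` on `[-A, A]`, where
`A` is the truncation radius, and `0` elsewhere. -/
def tlapWeight (Δ ε δ : ℝ) : Measure ℝ :=
  (volume.restrict (Set.Icc (-tlapRadius Δ ε δ) (tlapRadius Δ ε δ))).withDensity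
    fun x => ENNReal.ofReal (Real.exp (-(|x| * ε / Δ)))

/-- The truncated Laplace distribution `TLap(Δ, ε, δ)`. -/
def tlap (Δ ε δ : ℝ) : Measure ℝ := (tlapWeight Δ ε δ Set.univ)⁻¹ • tlapWeight Δ ε δ

/-! ### The data structure -/

/-- The exponent `ρ`. -/
def rho (α β : ℝ) : ℝ := (1 - α ^ 2) * (1 - β ^ 2) / (1 - α * β) ^ 2

/-- The number `m` of Gaussian filters for dataset size `n`. -/
def numFilters (n : ℕ) (α β : ℝ) : ℕ := ⌈(n : ℝ) ^ ((1 - β ^ 2) / (1 - α * β) ^ 2)⌉₊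

/-- The query threshold `η`. -/
def threshold (m : ℕ) (α : ℝ) : ℝ :=
  α * √(2 * Real.log m) - √(2 * (1 - α ^ 2) * Real.log (Real.log m))

/-- The released data structure with `m` filters in dimension `d`: the table of counters, the
filters, the query threshold. -/
structure Data (d m : ℕ) where
  table : Fin m → ℝ
  filters : Fin m → Vec d
  eta : ℝ

/-- A data structure as a tuple of its components. -/
def Data.toTuple {d m : ℕ} (D : Data d m) : (Fin m → ℝ) × (Fin m → Vec d) × ℝ :=
  (D.table, D.filters, D.eta)

/-- The sigma-algebra on data structures is the product one. -/
instance (d m : ℕ) : MeasurableSpace (Data d m) := MeasurableSpace.comap Data.toTuple inferInstance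

/-- `i` is the index (the first one, in case of ties) of the filter with the largest inner product
with `x`. -/
def IsArgmax {d m : ℕ} (a : Fin m → Vec d) (x : Vec d) (i : Fin m) : Prop :=
  (∀ j, ⟪a j, x⟫ ≤ ⟪a i, x⟫) ∧ ∀ j < i, ⟪a j, x⟫ < ⟪a i, x⟫

open Classical in
/-- The number of points of the dataset that are assigned to filter `i`. -/
def bucketCount {d m : ℕ} (a : Fin m → Vec d) (S : Multiset (Sph d)) (i : Fin m) : ℕ :=
  (S.filter fun x => IsArgmax a (x : Vec d) i).card

/-- CONSTRUCTION for given values of the random draws: `g i j` is the `j`-th coordinate of the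
`i`-th filter and `z i` is the noise added to the `i`-th counter. The size `n` that determines the
number of filters is a parameter of its own (a public quantity). -/
def build {d : ℕ} (n : ℕ) (α β ε δ : ℝ) (S : Multiset (Sph d))
    (g : Fin (numFilters n α β) → Fin d → ℝ) (z : Fin (numFilters n α β) → ℝ) :
    Data d (numFilters n α β) where
  table i :=
    if (bucketCount (fun k => WithLp.toLp 2 (g k)) S i : ℝ) + z i ≤ tlapRadius 1 ε δ then 0
    else (bucketCount (fun k => WithLp.toLp 2 (g k)) S i : ℝ) + z i
  filters k := WithLp.toLp 2 (g k)
  eta := threshold (numFilters n α β) α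

/-- The law of the random draws: all independent, standard Gaussian coordinates and truncated
Laplace noise. -/
def drawLaw (d m : ℕ) (ε δ : ℝ) : Measure ((Fin m → Fin d → ℝ) × (Fin m → ℝ)) :=
  (Measure.pi fun _ => Measure.pi fun _ => gaussianReal 0 1).prod (Measure.pi fun _ => tlap 1 ε δ)

/-- The output law of CONSTRUCTION on the dataset `S`. -/
def construction {d : ℕ} (n : ℕ) (α β ε δ : ℝ) (S : Multiset (Sph d)) :
    Measure (Data d (numFilters n α β)) :=
  (drawLaw d (numFilters n α β) ε δ).map fun ω => build n α β ε δ S ω.1 ω.2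

open Classical in
/-- QUERY: the sum of the counters of the filters whose inner product with `q` reaches the
threshold. -/
def Data.query {d m : ℕ} (D : Data d m) (q : Sph d) : ℝ :=
  ∑ i with D.eta ≤ ⟪D.filters i, (q : Vec d)⟫, D.table i

/-- The number of memory words of the data structure (filters, counters, threshold). -/
def Data.words {d m : ℕ} (_ : Data d m) : ℕ := 1 + m + m * d

/-! ### A randomized real RAM with unit-cost instructions

Finitely many integer and real registers are used by each program; the memory consists of real
words addressed by integer registers. -/

namespace RAM

/-- What a computation can only read: the input array, and two sources of random draws, each read
sequentially. -/
structure Env where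
  input : ℕ → ℝ
  gauss : ℕ → ℝ
  noise : ℕ → ℝ

/-- Machine states: integer registers, real registers, memory, and the number of draws already taken
from each source. -/
structure State where
  int : ℕ → ℕ
  real : ℕ → ℝ
  mem : ℕ → ℝ
  gaussPos : ℕ
  noisePos : ℕ

/-- Instructions; the first argument names the target register. -/
inductive Instr
  | intConst (i k : ℕ)
  | intAdd (i j k : ℕ)
  | intSub (i j k : ℕ)
  | intMul (i j k : ℕ)
  | ofInt (i j : ℕ)
  | add (i j k : ℕ)
  | sub (i j k : ℕ)
  | mul (i j k : ℕ)
  | div (i j k : ℕ)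
  | exp (i j : ℕ)
  | log (i j : ℕ)
  | sqrt (i j : ℕ)
  | ceil (i j : ℕ)
  | input (i j : ℕ)
  | load (i j : ℕ)
  | store (i j : ℕ)
  | gauss (i : ℕ)
  | noise (i : ℕ)

/-- Write an integer register. -/
def State.setInt (s : State) (i v : ℕ) : State := { s with int := Function.update s.int i v }

/-- Write a real register. -/
def State.setReal (s : State) (i : ℕ) (v : ℝ) : State :=
  { s with real := Function.update s.real i v }

/-- The effect of an instruction. -/
def Instr.exec (E : Env) (s : State) : Instr → State
  | intConst i k => s.setInt i k
  | intAdd i j k => s.setInt i (s.int j + s.int k)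
  | intSub i j k => s.setInt i (s.int j - s.int k)
  | intMul i j k => s.setInt i (s.int j * s.int k)
  | ofInt i j => s.setReal i (s.int j : ℝ)
  | add i j k => s.setReal i (s.real j + s.real k)
  | sub i j k => s.setReal i (s.real j - s.real k)
  | mul i j k => s.setReal i (s.real j * s.real k)
  | div i j k => s.setReal i (s.real j / s.real k)
  | exp i j => s.setReal i (Real.exp (s.real j))
  | log i j => s.setReal i (Real.log (s.real j))
  | sqrt i j => s.setReal i (√(s.real j))
  | ceil i j => s.setInt i ⌈s.real j⌉₊
  | input i j => s.setReal i (E.input (s.int j))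
  | load i j => s.setReal i (s.mem (s.int j))
  | store i j => { s with mem := Function.update s.mem (s.int i) (s.real j) }
  | gauss i => { s.setReal i (E.gauss s.gaussPos) with gaussPos := s.gaussPos + 1 }
  | noise i => { s.setReal i (E.noise s.noisePos) with noisePos := s.noisePos + 1 }

/-- An instruction can be executed on a machine with `K` words of memory if it accesses only
addresses below `K`. -/
def Instr.Allowed (K : ℕ) (s : State) : Instr → Prop
  | load _ j => s.int j < K
  | store i _ => s.int i < K
  | _ => True

/-- Tests. -/
inductive Test
  | intLt (i j : ℕ)
  | realLe (i j : ℕ)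

/-- The meaning of a test. -/
def Test.Holds (s : State) : Test → Prop
  | intLt i j => s.int i < s.int j
  | realLe i j => s.real i ≤ s.real j

/-- Programs. -/
inductive Prog
  | skip
  | instr (c : Instr)
  | seq (p q : Prog)
  | ite (b : Test) (p q : Prog)
  | loop (b : Test) (p : Prog)

/-- `Run E K p s t s'`: on a machine with `K` words of memory and read-only data `E`, the program
`p` started in state `s` halts in state `s'` after `t` steps. Every executed instruction and every
evaluated test is one step. -/
inductive Run (E : Env) (K : ℕ) : Prog → State → ℕ → State → Prop
  | skip (s : State) : Run E K .skip s 0 s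
  | instr (c : Instr) (s : State) (h : c.Allowed K s) : Run E K (.instr c) s 1 (c.exec E s)
  | seq {p q : Prog} {s s' s'' : State} {t t' : ℕ} (h : Run E K p s t s')
      (h' : Run E K q s' t' s'') : Run E K (.seq p q) s (t + t') s''
  | iteTrue {b : Test} {p q : Prog} {s s' : State} {t : ℕ} (hb : b.Holds s)
      (h : Run E K p s t s') : Run E K (.ite b p q) s (t + 1) s'
  | iteFalse {b : Test} {p q : Prog} {s s' : State} {t : ℕ} (hb : ¬ b.Holds s)
      (h : Run E K q s t s') : Run E K (.ite b p q) s (t + 1) s'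
  | loopTrue {b : Test} {p : Prog} {s s' s'' : State} {t t' : ℕ} (hb : b.Holds s)
      (h : Run E K p s t s') (h' : Run E K (.loop b p) s' t' s'') :
      Run E K (.loop b p) s (t + t' + 1) s''
  | loopFalse {b : Test} {p : Prog} {s : State} (hb : ¬ b.Holds s) : Run E K (.loop b p) s 1 s

/-- The data structure `D` is stored in state `s`: the integer registers `0` and `1` hold `m` and
`d`, and the memory holds the threshold, then the counters, then the filters row by row. -/
def Stores {d m : ℕ} (s : State) (D : Data d m) : Prop :=
  s.int 0 = m ∧ s.int 1 = d ∧ s.mem 0 = D.eta ∧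
    (∀ i : Fin m, s.mem (1 + i) = D.table i) ∧
    ∀ (i : Fin m) (j : Fin d), s.mem (1 + m + (i * d + j)) = D.filters i j

/-- Initial configurations of CONSTRUCTION: integer registers `0` and `1` hold `n` and `d`, real
registers `0` to `3` hold `α, β, ε, δ`, the input array holds the dataset row by row, and the random
sources, not yet used, start with the draws `g` (row by row) and `z`. -/
def Init {n d m : ℕ} (α β ε δ : ℝ) (x : Fin n → Sph d) (g : Fin m → Fin d → ℝ) (z : Fin m → ℝ)
    (E : Env) (s : State) : Prop :=
  s.int 0 = n ∧ s.int 1 = d ∧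
    s.real 0 = α ∧ s.real 1 = β ∧ s.real 2 = ε ∧ s.real 3 = δ ∧
    s.gaussPos = 0 ∧ s.noisePos = 0 ∧
    (∀ (i : Fin n) (j : Fin d), E.input (i * d + j) = (x i : Vec d) j) ∧
    (∀ (i : Fin m) (j : Fin d), E.gauss (i * d + j) = g i j) ∧
    ∀ i : Fin m, E.noise i = z i

end RAM

end DPTopOne

end

open DPTopOne

/-!
Adding a point to the dataset increases a single counter by one, and shifting `TLap(1, ε, δ)` by one
changes probabilities by at most a factor `e ^ ε` and an additive `δ`. Both survive independent
draws and post-processing, in particular the removal of the counters `≤ A`.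

For accuracy, fix the query `q`. The maximum of the `m` Gaussian variables `⟪a_j, x⟫` exceeds a
level `M` close to `√(2 log m)` with high probability, so `x` is assigned to a bad filter only if
some `a_j` has `⟪a_j, x⟫ ≥ M` and an atypical inner product with `q`: smaller than `η` for points
with `⟪q, x⟫ ≥ α`, at least `η` for points with `⟪q, x⟫ < β`. By a Chernoff bound for correlated
Gaussian variables, the former has probability `o(1)` and the latter is expected for about
`n * m ^ (-(α - β) ^ 2 / (1 - β ^ 2)) = n ^ ρ` points. The query reads about
`m * exp (-η ^ 2 / 2) ≈ m ^ (1 - α ^ 2) = n ^ ρ` filters, each of which is off by at most `2 * A`.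
Markov's inequality for these three counts gives the success probability `2 / 3`.

The running times of both programs are dominated by the inner products with the
`m = O(n ^ (ρ / (1 - α ^ 2)))` filters.
-/

noncomputable section

namespace DPTopOne

/-! ### Approximate domination of measures -/

section ApproxLE

variable {Ω Ω' : Type*} [MeasurableSpace Ω] [MeasurableSpace Ω'] {ε δ : ℝ} {μ ν : Measure Ω}

/-- One-sided `(ε, δ)`-indistinguishability of two measures, so that `IsDP ε δ M` says that
`ApproxLE ε δ (M S) (M S')` for all neighbouring `S`, `S'`. -/
def ApproxLE (ε δ : ℝ) (μ ν : Measure Ω) : Prop :=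
  ∀ Y, MeasurableSet Y → μ Y ≤ ENNReal.ofReal (Real.exp ε) * ν Y + ENNReal.ofReal δ

lemma ApproxLE.of_eq (hε : 0 ≤ ε) (h : μ = ν) : ApproxLE ε δ μ ν := fun Y _ => by
  rw [h]
  refine le_add_right (le_mul_of_one_le_left zero_le ?_)
  exact ENNReal.one_le_ofReal.2 (Real.one_le_exp hε)

lemma ApproxLE.map (h : ApproxLE ε δ μ ν) {f : Ω → Ω'} (hf : Measurable f) :
    ApproxLE ε δ (μ.map f) (ν.map f) := fun Y hY => by
  rw [Measure.map_apply hf hY, Measure.map_apply hf hY]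
  exact h _ (hf hY)

lemma ApproxLE.map_prod {G : Type*} [MeasurableSpace G] {P : Measure G} [IsProbabilityMeasure P]
    [SFinite μ] [SFinite ν] {f f' : G × Ω → Ω'} (hf : Measurable f) (hf' : Measurable f')
    (h : ∀ g, ApproxLE ε δ (μ.map fun z => f (g, z)) (ν.map fun z => f' (g, z))) :
    ApproxLE ε δ ((P.prod μ).map f) ((P.prod ν).map f') := by
  intro Y hY
  have hsection : ∀ g, μ (Prod.mk g ⁻¹' (f ⁻¹' Y)) ≤
      ENNReal.ofReal (Real.exp ε) * ν (Prod.mk g ⁻¹' (f' ⁻¹' Y)) + ENNReal.ofReal δ := by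
    intro g
    have hfg : Measurable fun z => f (g, z) := hf.comp measurable_prodMk_left
    have hfg' : Measurable fun z => f' (g, z) := hf'.comp measurable_prodMk_left
    have hg := h g Y hY
    rw [Measure.map_apply hfg hY, Measure.map_apply hfg' hY] at hg
    exact hg
  rw [Measure.map_apply hf hY, Measure.map_apply hf' hY, Measure.prod_apply (hf hY),
    Measure.prod_apply (hf' hY)]
  calc ∫⁻ g, μ (Prod.mk g ⁻¹' (f ⁻¹' Y)) ∂P
      ≤ ∫⁻ g, ENNReal.ofReal (Real.exp ε) * ν (Prod.mk g ⁻¹' (f' ⁻¹' Y)) +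
          ENNReal.ofReal δ ∂P := lintegral_mono hsection
    _ = _ := by
      rw [lintegral_add_right _ measurable_const,
        lintegral_const_mul _ (measurable_measure_prodMk_left (hf' hY)), lintegral_const,
        measure_univ, mul_one]

lemma ApproxLE.pi_update {m : ℕ} [IsProbabilityMeasure μ] {f : Ω → Ω} (hf : Measurable f)
    (h : ApproxLE ε δ (μ.map f) μ) (i : Fin m) :
    ApproxLE ε δ ((Measure.pi fun _ : Fin m => μ).map fun z => Function.update z i (f (z i)))
      (Measure.pi fun _ => μ) := by
  obtain _ | k := m
  · exact i.elim0
  let e : (Fin k → Ω) × Ω → Fin (k + 1) → Ω := fun p => i.insertNth p.2 p.1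
  have he : MeasurePreserving e ((Measure.pi fun _ => μ).prod μ) (Measure.pi fun _ => μ) :=
    (measurePreserving_piFinSuccAbove (fun _ => μ) i).symm.comp Measure.measurePreserving_swap
  have hupdate : ∀ p, Function.update (e p) i (f (e p i)) = e (p.1, f p.2) := fun p => by
    simp only [e, Fin.insertNth_apply_same, Fin.update_insertNth]
  have hmeas : Measurable fun z : Fin (k + 1) → Ω => Function.update z i (f (z i)) :=
    measurable_update'.comp (measurable_id.prodMk (hf.comp (measurable_pi_apply i)))
  have hshift : Measurable fun p : (Fin k → Ω) × Ω => e (p.1, f p.2) :=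
    he.measurable.comp (measurable_fst.prodMk (hf.comp measurable_snd))
  rw [← he.map_eq, Measure.map_map hmeas he.measurable]
  simp only [Function.comp_def, hupdate]
  refine ApproxLE.map_prod hshift he.measurable fun y => ?_
  have hy : Measurable fun x => e (y, x) := he.measurable.comp measurable_prodMk_left
  rw [show (fun x => e ((y, x).1, f (y, x).2)) = (fun x => e (y, x)) ∘ f from rfl,
    ← Measure.map_map hy hf]
  exact h.map hy

end ApproxLE

/-! ### The truncated Laplace distribution -/

section TruncatedLaplace

variable {Δ ε δ c : ℝ}

lemma exp_tlapRadius_mul_div (hΔ : Δ ≠ 0) (hε : 0 < ε) (hδ : 0 < δ) :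
    Real.exp (tlapRadius Δ ε δ * ε / Δ) = 1 + (Real.exp ε - 1) / (2 * δ) := by
  have hfrac : 0 ≤ (Real.exp ε - 1) / (2 * δ) :=
    div_nonneg (sub_nonneg.2 (Real.one_le_exp hε.le)) (by positivity)
  have hexp : tlapRadius Δ ε δ * ε / Δ = Real.log (1 + (Real.exp ε - 1) / (2 * δ)) := by
    rw [tlapRadius]
    field_simp
  rw [hexp, Real.exp_log (by linarith)]

lemma le_tlapRadius (hΔ : 0 < Δ) (hε : 0 < ε) (hδ : 0 < δ) (hδ' : δ ≤ 1 / 2) :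
    Δ ≤ tlapRadius Δ ε δ := by
  have hfrac : Real.exp ε - 1 ≤ (Real.exp ε - 1) / (2 * δ) :=
    le_div_self (sub_nonneg.2 (Real.one_le_exp hε.le)) (by positivity) (by linarith)
  have hexp : ε ≤ tlapRadius Δ ε δ * ε / Δ := by
    rw [← Real.exp_le_exp, exp_tlapRadius_mul_div hΔ.ne' hε hδ]
    linarith
  rw [le_div_iff₀ hΔ, mul_comm] at hexp
  exact le_of_mul_le_mul_right hexp hε

lemma tlapWeight_apply {Y : Set ℝ} (hY : MeasurableSet Y) :
    tlapWeight Δ ε δ Y = ∫⁻ x in Y ∩ Set.Icc (-tlapRadius Δ ε δ) (tlapRadius Δ ε δ),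
      ENNReal.ofReal (Real.exp (-(|x| * ε / Δ))) := by
  rw [tlapWeight, withDensity_apply _ hY, Measure.restrict_restrict hY]

instance isNegInvariant_tlapWeight : (tlapWeight Δ ε δ).IsNegInvariant where
  neg_eq_self := by
    ext Y hY
    rw [Measure.neg_apply, tlapWeight_apply hY.neg, tlapWeight_apply hY,
      ← (Measure.measurePreserving_neg volume).setLIntegral_comp_preimage_emb
        (MeasurableEquiv.neg ℝ).measurableEmbedding]
    simp only [abs_neg, Set.preimage_inter, Set.neg_preimage, neg_neg, Set.neg_Icc]

instance isNegInvariant_tlap : (tlap Δ ε δ).IsNegInvariant where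
  neg_eq_self := by
    rw [tlap, Measure.neg_def, Measure.map_smul, Measure.map_neg_eq_self]

lemma tlapWeight_Ioc {a b : ℝ} (hΔ : Δ ≠ 0) (hε : ε ≠ 0) (ha : 0 ≤ a) (hab : a ≤ b)
    (hb : b ≤ tlapRadius Δ ε δ) :
    tlapWeight Δ ε δ (Set.Ioc a b) =
      ENNReal.ofReal (Δ / ε * (Real.exp (-(a * ε / Δ)) - Real.exp (-(b * ε / Δ)))) := by
  have hderiv : ∀ x ∈ Set.uIcc a b,
      HasDerivAt (fun x => -(Δ / ε) * Real.exp (-(x * ε / Δ))) (Real.exp (-(x * ε / Δ))) x := by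
    intro x _
    have h := (((hasDerivAt_id x).mul_const ε).div_const Δ).neg.exp.const_mul (-(Δ / ε))
    refine h.congr_deriv ?_
    simp only [id, Pi.neg_apply]
    field_simp
  have hint : IntervalIntegrable (fun x => Real.exp (-(x * ε / Δ))) volume a b :=
    Continuous.intervalIntegrable (by fun_prop) _ _
  have hsub : Set.Ioc a b ⊆ Set.Icc (-tlapRadius Δ ε δ) (tlapRadius Δ ε δ) := fun x hx =>
    ⟨by linarith [hx.1], hx.2.trans hb⟩
  calc tlapWeight Δ ε δ (Set.Ioc a b)
      = ∫⁻ x in Set.Ioc a b, ENNReal.ofReal (Real.exp (-(|x| * ε / Δ))) := by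
        rw [tlapWeight_apply measurableSet_Ioc, Set.inter_eq_left.2 hsub]
    _ = ∫⁻ x in Set.Ioc a b, ENNReal.ofReal (Real.exp (-(x * ε / Δ))) :=
        setLIntegral_congr_fun measurableSet_Ioc fun x hx => by rw [abs_of_pos (ha.trans_lt hx.1)]
    _ = ENNReal.ofReal (∫ x in a..b, Real.exp (-(x * ε / Δ))) := by
        rw [intervalIntegral.integral_of_le hab, ofReal_integral_eq_lintegral_ofReal hint.1
          (Eventually.of_forall fun x => (Real.exp_pos _).le)]
    _ = _ := by
        rw [intervalIntegral.integral_eq_sub_of_hasDerivAt hderiv hint]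
        congr 1
        ring

lemma two_mul_tlapWeight_Ioc_le :
    2 * tlapWeight Δ ε δ (Set.Ioc 0 (tlapRadius Δ ε δ)) ≤ tlapWeight Δ ε δ Set.univ := by
  set I := Set.Ioc 0 (tlapRadius Δ ε δ)
  have hdisj : Disjoint I (-I) := Set.disjoint_left.2 fun x hx hx' => by
    linarith [hx.1, (Set.mem_neg.1 hx').1]
  calc 2 * tlapWeight Δ ε δ I = tlapWeight Δ ε δ (I ∪ -I) := by
        rw [measure_union hdisj measurableSet_Ioc.neg, Measure.measure_neg, two_mul]
    _ ≤ tlapWeight Δ ε δ Set.univ := measure_mono (Set.subset_univ _)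

lemma tlapWeight_univ_ne_zero (hΔ : 0 < Δ) (hε : 0 < ε) (hδ : 0 < δ) (hδ' : δ ≤ 1 / 2) :
    tlapWeight Δ ε δ Set.univ ≠ 0 := by
  have hA : 0 < tlapRadius Δ ε δ := hΔ.trans_le (le_tlapRadius hΔ hε hδ hδ')
  have hpos : tlapWeight Δ ε δ (Set.Ioc 0 (tlapRadius Δ ε δ)) ≠ 0 := by
    rw [tlapWeight_Ioc hΔ.ne' hε.ne' le_rfl hA.le le_rfl]
    have hlt : Real.exp (-(tlapRadius Δ ε δ * ε / Δ)) < Real.exp (-(0 * ε / Δ)) :=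
      Real.exp_lt_exp.2 (neg_lt_neg (by gcongr))
    exact (ENNReal.ofReal_pos.2 (mul_pos (div_pos hΔ hε) (sub_pos.2 hlt))).ne'
  exact fun h => hpos (measure_mono_null (Set.subset_univ _) h)

instance isFiniteMeasure_tlapWeight : IsFiniteMeasure (tlapWeight Δ ε δ) := by
  refine isFiniteMeasure_withDensity_ofReal (Continuous.integrableOn_Icc ?_).2
  fun_prop

lemma isProbabilityMeasure_tlap (hΔ : 0 < Δ) (hε : 0 < ε) (hδ : 0 < δ) (hδ' : δ ≤ 1 / 2) :
    IsProbabilityMeasure (tlap Δ ε δ) := by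
  have : NeZero (tlapWeight Δ ε δ) :=
    ⟨Measure.measure_univ_ne_zero.1 (tlapWeight_univ_ne_zero hΔ hε hδ hδ')⟩
  exact isProbabilityMeasureSMul

lemma ae_tlap_abs_le : ∀ᵐ x ∂tlap Δ ε δ, |x| ≤ tlapRadius Δ ε δ := by
  have h : ∀ᵐ x ∂tlapWeight Δ ε δ, |x| ≤ tlapRadius Δ ε δ := by
    refine (withDensity_absolutelyContinuous _ _).ae_le ?_
    filter_upwards [ae_restrict_mem measurableSet_Icc] with x hx using abs_le.2 hx
  exact Measure.ae_smul_measure h _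

/-- The truncation radius is chosen to make this bound sharp. -/
lemma tlapWeight_tail_le (hΔ : 0 < Δ) (hε : 0 < ε) (hδ : 0 < δ) (hδ' : δ ≤ 1 / 2) :
    tlapWeight Δ ε δ (Set.Ioc (tlapRadius Δ ε δ - Δ) (tlapRadius Δ ε δ)) ≤
      ENNReal.ofReal δ * tlapWeight Δ ε δ Set.univ := by
  have hA := le_tlapRadius hΔ hε hδ hδ'
  have hexp := exp_tlapRadius_mul_div hΔ.ne' hε hδ
  refine le_trans (le_of_eq ?_) (mul_le_mul_right two_mul_tlapWeight_Ioc_le _)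
  rw [tlapWeight_Ioc hΔ.ne' hε.ne' le_rfl (hΔ.le.trans hA) le_rfl,
    tlapWeight_Ioc hΔ.ne' hε.ne' (sub_nonneg.2 hA) (by linarith) le_rfl,
    ← ENNReal.ofReal_ofNat 2, ← ENNReal.ofReal_mul zero_le_two, ← ENNReal.ofReal_mul hδ.le]
  have hshift : -((tlapRadius Δ ε δ - Δ) * ε / Δ) = ε + -(tlapRadius Δ ε δ * ε / Δ) := by
    field_simp
    ring
  rw [hshift, Real.exp_add, zero_mul, zero_div, neg_zero, Real.exp_zero, Real.exp_neg]
  congr 1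
  field_simp
  rw [mul_comm ε, hexp]
  field_simp
  ring

lemma tlapWeight_shift_le (hΔ : 0 < Δ) (hε : 0 < ε) (hδ : 0 < δ) (hδ' : δ ≤ 1 / 2) (hc : 0 ≤ c)
    (hcΔ : c ≤ Δ) {Y : Set ℝ} (hY : MeasurableSet Y) :
    tlapWeight Δ ε δ ((· + c) ⁻¹' Y) ≤ ENNReal.ofReal (Real.exp ε) * tlapWeight Δ ε δ Y +
      ENNReal.ofReal δ * tlapWeight Δ ε δ Set.univ := by
  set A := tlapRadius Δ ε δ
  set I := Set.Icc (-A) A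
  let f : ℝ → ℝ≥0∞ := fun x => ENNReal.ofReal (Real.exp (-(|x| * ε / Δ)))
  have hf : Measurable f := by fun_prop
  have hYc : MeasurableSet ((· + c) ⁻¹' Y) := measurable_add_const c hY
  have hsplit : (· + c) ⁻¹' Y ∩ I ⊆ (· + c) ⁻¹' (Y ∩ I) ∪ Set.Ioc (A - Δ) A ∩ I := by
    rintro x ⟨hxY, hx⟩
    rcases le_or_gt (x + c) A with h | h
    · exact Or.inl ⟨hxY, by linarith [hx.1], h⟩
    · exact Or.inr ⟨⟨by linarith, hx.2⟩, hx⟩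
  have hdensity : ∀ x, f x ≤ ENNReal.ofReal (Real.exp ε) * f (x + c) := by
    intro x
    rw [← ENNReal.ofReal_mul (Real.exp_pos _).le, ← Real.exp_add]
    refine ENNReal.ofReal_le_ofReal (Real.exp_le_exp.2 ?_)
    have habs : |x + c| ≤ |x| + Δ := (abs_add_le x c).trans (by rw [abs_of_nonneg hc]; gcongr)
    have : |x + c| * ε / Δ ≤ |x| * ε / Δ + ε := by
      rw [div_add' _ _ _ hΔ.ne']
      gcongr
      nlinarith
    linarith
  calc tlapWeight Δ ε δ ((· + c) ⁻¹' Y)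
      = ∫⁻ x in (· + c) ⁻¹' Y ∩ I, f x := tlapWeight_apply hYc
    _ ≤ (∫⁻ x in (· + c) ⁻¹' (Y ∩ I), f x) + ∫⁻ x in Set.Ioc (A - Δ) A ∩ I, f x :=
        (lintegral_mono_set hsplit).trans (lintegral_union_le _ _ _)
    _ ≤ (∫⁻ x in (· + c) ⁻¹' (Y ∩ I), ENNReal.ofReal (Real.exp ε) * f (x + c)) +
          tlapWeight Δ ε δ (Set.Ioc (A - Δ) A) :=
        add_le_add (lintegral_mono hdensity) (tlapWeight_apply measurableSet_Ioc).ge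
    _ = ENNReal.ofReal (Real.exp ε) * tlapWeight Δ ε δ Y +
          tlapWeight Δ ε δ (Set.Ioc (A - Δ) A) := by
        rw [(measurePreserving_add_right volume c).setLIntegral_comp_preimage
          (hY.inter measurableSet_Icc) (hf.const_mul _), lintegral_const_mul _ hf,
          tlapWeight_apply hY]
    _ ≤ _ := by gcongr; exact tlapWeight_tail_le hΔ hε hδ hδ'

lemma approxLE_tlap_map_add (hΔ : 0 < Δ) (hε : 0 < ε) (hδ : 0 < δ) (hδ' : δ ≤ 1 / 2)
    (hc : |c| ≤ Δ) : ApproxLE ε δ ((tlap Δ ε δ).map (· + c)) (tlap Δ ε δ) := by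
  have hnonneg : ∀ c, 0 ≤ c → c ≤ Δ →
      ApproxLE ε δ ((tlap Δ ε δ).map (· + c)) (tlap Δ ε δ) := by
    intro c hc0 hcΔ Y hY
    rw [Measure.map_apply (measurable_add_const c) hY]
    have hne := tlapWeight_univ_ne_zero hΔ hε hδ hδ'
    calc tlap Δ ε δ ((· + c) ⁻¹' Y)
        ≤ (tlapWeight Δ ε δ Set.univ)⁻¹ * (ENNReal.ofReal (Real.exp ε) * tlapWeight Δ ε δ Y +
            ENNReal.ofReal δ * tlapWeight Δ ε δ Set.univ) :=
          mul_le_mul_right (tlapWeight_shift_le hΔ hε hδ hδ' hc0 hcΔ hY) _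
      _ = _ := by
          rw [mul_add, mul_left_comm, mul_left_comm _ (ENNReal.ofReal δ),
            ENNReal.inv_mul_cancel hne (measure_ne_top _ _), mul_one]
          rfl
  rcases le_total 0 c with h | h
  · exact hnonneg c h ((le_abs_self c).trans hc)
  · have hneg := (hnonneg (-c) (neg_nonneg.2 h) ((neg_le_abs c).trans hc)).map measurable_neg
    rw [Measure.map_map measurable_neg (measurable_add_const _), Measure.map_neg_eq_self] at hneg
    have hcomm : Neg.neg ∘ (· + -c) = (· + c) ∘ Neg.neg := by
      ext x
      simp only [Function.comp_apply, neg_add, neg_neg]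
    rwa [hcomm, ← Measure.map_map (measurable_add_const _) measurable_neg,
      Measure.map_neg_eq_self] at hneg

end TruncatedLaplace

/-! ### Assignment of points to filters -/

section Assignment

variable {d m : ℕ} {a : Fin m → Vec d} {x : Vec d} {i j : Fin m}

lemma IsArgmax.unique (hi : IsArgmax a x i) (hj : IsArgmax a x j) : i = j :=
  le_antisymm (le_of_not_gt fun h => (hi.2 j h).not_ge (hj.1 i))
    (le_of_not_gt fun h => (hj.2 i h).not_ge (hi.1 j))

lemma exists_isArgmax (hm : 0 < m) (a : Fin m → Vec d) (x : Vec d) : ∃ i, IsArgmax a x i := by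
  have : Nonempty (Fin m) := ⟨⟨0, hm⟩⟩
  obtain ⟨i, hi⟩ := Finite.exists_max fun i => toLex (⟪a i, x⟫, OrderDual.toDual i)
  have hlex : ∀ j, ⟪a j, x⟫ < ⟪a i, x⟫ ∨ ⟪a j, x⟫ = ⟪a i, x⟫ ∧ i ≤ j := fun j =>
    Prod.Lex.toLex_le_toLex.1 (hi j)
  exact ⟨i, fun j => (hlex j).elim le_of_lt fun h => h.1.le,
    fun j hj => (hlex j).resolve_right fun h => h.2.not_gt hj⟩

/-- The filters with given coordinates, in the form in which they occur in `build`. -/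
def toFilters (g : Fin m → Fin d → ℝ) : Fin m → Vec d := fun k => WithLp.toLp 2 (g k)

lemma measurable_inner_toLp (w : Vec d) :
    Measurable fun v : Fin d → ℝ => ⟪(WithLp.toLp 2 v : Vec d), w⟫ :=
  (WithLp.measurable_toLp 2 _).inner_const

lemma measurable_inner_toFilters (x : Vec d) (i : Fin m) :
    Measurable fun g : Fin m → Fin d → ℝ => ⟪toFilters g i, x⟫ :=
  (measurable_inner_toLp x).comp (measurable_pi_apply i)

lemma measurableSet_isArgmax (x : Vec d) (i : Fin m) :
    MeasurableSet {g : Fin m → Fin d → ℝ | IsArgmax (toFilters g) x i} := by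
  have hinner := measurable_inner_toFilters (m := m) x
  simp only [IsArgmax, Set.ofPred_and, Set.ofPred_forall]
  exact (MeasurableSet.iInter fun j => measurableSet_le (hinner j) (hinner i)).inter
    (MeasurableSet.iInter fun j => MeasurableSet.iInter fun _ =>
      measurableSet_lt (hinner j) (hinner i))

open Classical in
lemma bucketCount_eq (a : Fin m → Vec d) (S : Multiset (Sph d)) (i : Fin m) :
    bucketCount a S i =
      ((S.map (Subtype.val : Sph d → Vec d)).filter fun x => IsArgmax a x i).card := by
  unfold bucketCount
  simp only [Multiset.pure_def, Multiset.bind_def, Multiset.bind_singleton]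

open Classical in
lemma bucketCount_cons (a : Fin m → Vec d) (S : Multiset (Sph d)) (x : Sph d) (i : Fin m) :
    bucketCount a (x ::ₘ S) i = bucketCount a S i + if IsArgmax a (x : Vec d) i then 1 else 0 := by
  rw [bucketCount_eq, bucketCount_eq, Multiset.map_cons, Multiset.filter_cons, Multiset.card_add,
    add_comm]
  split_ifs <;> rfl

lemma IsArgmax.bucketCount_cons {x : Sph d} (h : IsArgmax a (x : Vec d) i)
    (S : Multiset (Sph d)) :
    bucketCount a (x ::ₘ S) = bucketCount a S + Pi.single i 1 := by
  classical
  ext j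
  have hij : IsArgmax a (x : Vec d) j ↔ j = i := ⟨fun hj => hj.unique h, fun hj => hj ▸ h⟩
  rw [DPTopOne.bucketCount_cons, Pi.add_apply, Pi.single_apply]
  simp only [hij]

lemma measurable_bucketCount (S : Multiset (Sph d)) (i : Fin m) :
    Measurable fun g : Fin m → Fin d → ℝ => bucketCount (toFilters g) S i := by
  classical
  induction S using Multiset.induction with
  | empty => exact measurable_const
  | cons x S ih =>
    simp only [bucketCount_cons]
    exact ih.add (Measurable.ite (measurableSet_isArgmax _ i) measurable_const measurable_const)

/-- The filter to which `x` is assigned has inner product at least `t` with `q`, so that a query at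
`q` with threshold `t` counts `x`. -/
def Reaches (a : Fin m → Vec d) (x q : Vec d) (t : ℝ) : Prop :=
  ∃ i, IsArgmax a x i ∧ t ≤ ⟪a i, q⟫

lemma measurableSet_reaches (x q : Vec d) (t : ℝ) :
    MeasurableSet {g : Fin m → Fin d → ℝ | Reaches (toFilters g) x q t} := by
  simp only [Reaches, Set.ofPred_exists, Set.ofPred_and]
  exact MeasurableSet.iUnion fun i => (measurableSet_isArgmax x i).inter
    (measurable_inner_toFilters q i measurableSet_Ici)

end Assignment

/-! ### Privacy -/

section Privacy

variable {d : ℕ} (n : ℕ) (α β : ℝ) {ε δ : ℝ}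

lemma measurable_build (ε δ : ℝ) (S : Multiset (Sph d)) :
    Measurable fun ω : (Fin (numFilters n α β) → Fin d → ℝ) × (Fin (numFilters n α β) → ℝ) =>
      build n α β ε δ S ω.1 ω.2 := by
  refine measurable_comap_iff.2 (Measurable.prodMk ?_ (Measurable.prodMk ?_ measurable_const))
  · refine measurable_pi_lambda _ fun i => ?_
    have hcounter : Measurable fun ω : (Fin (numFilters n α β) → Fin d → ℝ) ×
        (Fin (numFilters n α β) → ℝ) => (bucketCount (toFilters ω.1) S i : ℝ) + ω.2 i :=
      (measurable_from_top.comp ((measurable_bucketCount S i).comp measurable_fst)).add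
        ((measurable_pi_apply i).comp measurable_snd)
    exact Measurable.ite (measurableSet_le hcounter measurable_const) measurable_const hcounter
  · exact measurable_pi_lambda _ fun i =>
      (WithLp.measurable_toLp 2 _).comp ((measurable_pi_apply i).comp measurable_fst)

variable {n α β} in
lemma build_congr {S S' : Multiset (Sph d)} {g : Fin (numFilters n α β) → Fin d → ℝ}
    {z z' : Fin (numFilters n α β) → ℝ}
    (h : ∀ i, (bucketCount (toFilters g) S i : ℝ) + z i =
      bucketCount (toFilters g) S' i + z' i) :
    build n α β ε δ S g z = build n α β ε δ S' g z' := by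
  unfold toFilters at h
  simp only [build, h]

lemma exists_build_eq_build_update {S S' : Multiset (Sph d)} (hS : Neighbouring S S')
    (hm : 0 < numFilters n α β) (g : Fin (numFilters n α β) → Fin d → ℝ) :
    ∃ (i : Fin (numFilters n α β)) (c : ℝ), |c| ≤ 1 ∧ ∀ z,
      build n α β ε δ S g z = build n α β ε δ S' g (Function.update z i (z i + c)) := by
  obtain ⟨x, hx⟩ := hS
  obtain ⟨i, hi⟩ := exists_isArgmax hm (toFilters g) (x : Vec d)
  have hupdate : ∀ (c : ℝ) (z : Fin (numFilters n α β) → ℝ) (j), Function.update z i (z i + c) j =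
      z j + if j = i then c else 0 := by
    intro c z j
    by_cases h : j = i
    · subst h
      rw [Function.update_self, if_pos rfl]
    · rw [Function.update_of_ne h, if_neg h, add_zero]
  rcases hx with rfl | rfl
  · refine ⟨i, -1, by norm_num, fun z => build_congr fun j => ?_⟩
    rw [hupdate, hi.bucketCount_cons, Pi.add_apply, Pi.single_apply]
    split_ifs <;> push_cast <;> ring
  · refine ⟨i, 1, by norm_num, fun z => build_congr fun j => ?_⟩
    rw [hupdate, hi.bucketCount_cons, Pi.add_apply, Pi.single_apply]
    split_ifs <;> push_cast <;> ring

theorem construction_isDP (hε : 0 < ε) (hδ : 0 < δ) (hδ' : δ ≤ 1 / 2) :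
    IsDP ε δ fun S : Multiset (Sph d) => construction n α β ε δ S := by
  intro S S' hS
  have := isProbabilityMeasure_tlap one_pos hε hδ hδ'
  have hmeas := measurable_build (d := d) n α β ε δ
  refine ApproxLE.map_prod (hmeas S) (hmeas S') fun g => ?_
  rcases (numFilters n α β).eq_zero_or_pos with hm | hm
  · have : IsEmpty (Fin (numFilters n α β)) := hm ▸ Fin.isEmpty
    have hbuild : (fun z => build n α β ε δ S g z) = fun z => build n α β ε δ S' g z :=
      funext fun z => build_congr isEmptyElim
    exact ApproxLE.of_eq hε.le (congrArg (Measure.map · _) hbuild)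
  · obtain ⟨i, c, hc, hbuild⟩ := exists_build_eq_build_update (ε := ε) (δ := δ) n α β hS hm g
    have hg : Measurable fun z => build n α β ε δ S' g z :=
      (hmeas S').of_uncurry_left (f := build n α β ε δ S')
    have hshift : Measurable fun z : Fin (numFilters n α β) → ℝ =>
        Function.update z i (z i + c) :=
      measurable_update'.comp
        (measurable_id.prodMk ((measurable_pi_apply i).add (measurable_const (a := c))))
    have hnoise := (approxLE_tlap_map_add one_pos hε hδ hδ' hc).pi_update
      (measurable_add_const c) i
    have hmap := hnoise.map hg
    rw [Measure.map_map hg hshift] at hmap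
    exact (funext hbuild : (fun z => build n α β ε δ S g z) = _) ▸ hmap

lemma isProbabilityMeasure_drawLaw (d m : ℕ) (hε : 0 < ε) (hδ : 0 < δ) (hδ' : δ ≤ 1 / 2) :
    IsProbabilityMeasure (drawLaw d m ε δ) := by
  have := isProbabilityMeasure_tlap one_pos hε hδ hδ'
  unfold drawLaw
  infer_instance

theorem isProbabilityMeasure_construction (hε : 0 < ε) (hδ : 0 < δ) (hδ' : δ ≤ 1 / 2)
    (S : Multiset (Sph d)) : IsProbabilityMeasure (construction n α β ε δ S) := by
  have := isProbabilityMeasure_drawLaw d (numFilters n α β) hε hδ hδ'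
  exact Measure.isProbabilityMeasure_map (measurable_build n α β ε δ S).aemeasurable

end Privacy

/-! ### Gaussian filters -/

section GaussianFilters

variable {d m : ℕ} {x q w : Vec d} {M r t : ℝ}

/-- The standard Gaussian law on coordinate vectors. -/
abbrev gaussVec (d : ℕ) : Measure (Fin d → ℝ) := Measure.pi fun _ => gaussianReal 0 1

/-- The law of `m` independent standard Gaussian vectors. -/
abbrev gaussFilters (d m : ℕ) : Measure (Fin m → Fin d → ℝ) := Measure.pi fun _ => gaussVec d

lemma map_inner_gaussVec (w : Vec d) :
    (gaussVec d).map (fun v => ⟪(WithLp.toLp 2 v : Vec d), w⟫) =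
      gaussianReal 0 (‖w‖ ^ 2).toNNReal := by
  have h := IsGaussian.map_eq_gaussianReal (μ := stdGaussian (Vec d)) (innerSL ℝ w)
  rw [integral_strongDual_stdGaussian, variance_dual_stdGaussian, innerSL_apply_norm,
    ← map_pi_eq_stdGaussian, Measure.map_map (by fun_prop) (WithLp.measurable_toLp 2 _)] at h
  rw [← h]
  congr 1
  ext v
  exact real_inner_comm _ _

lemma gaussVec_inner_ge_le (w : Vec d) (t : ℝ) :
    (gaussVec d).real {v | t ≤ ⟪(WithLp.toLp 2 v : Vec d), w⟫} ≤ Real.exp (-t + ‖w‖ ^ 2 / 2) := by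
  have hint : Integrable (fun v : Fin d → ℝ => Real.exp (1 * ⟪(WithLp.toLp 2 v : Vec d), w⟫))
      (gaussVec d) := by
    have h := integrable_exp_mul_gaussianReal (μ := 0) (v := (‖w‖ ^ 2).toNNReal) 1
    rw [← map_inner_gaussVec w] at h
    exact h.comp_measurable (measurable_inner_toLp w)
  refine (measure_ge_le_exp_mul_mgf t zero_le_one hint).trans_eq ?_
  rw [mgf_gaussianReal (map_inner_gaussVec w), Real.coe_toNNReal _ (sq_nonneg _), ← Real.exp_add]
  ring_nf

lemma gaussVec_inner_ge_inner_ge_le_of_multipliers (hx : ‖x‖ = 1) (hq : ‖q‖ = 1)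
    (hr : ⟪x, q⟫ ≤ r) (M t : ℝ) {l u : ℝ} (hl : 0 ≤ l) (hu : 0 ≤ u) :
    (gaussVec d).real {v | M ≤ ⟪(WithLp.toLp 2 v : Vec d), x⟫ ∧
        t ≤ ⟪(WithLp.toLp 2 v : Vec d), q⟫} ≤
      Real.exp (-(l * M + u * t) + (l ^ 2 + u ^ 2 + 2 * (l * u) * r) / 2) := by
  have hsub : {v | M ≤ ⟪(WithLp.toLp 2 v : Vec d), x⟫ ∧ t ≤ ⟪(WithLp.toLp 2 v : Vec d), q⟫} ⊆
      {v | l * M + u * t ≤ ⟪(WithLp.toLp 2 v : Vec d), l • x + u • q⟫} := by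
    rintro v ⟨hvx, hvq⟩
    change l * M + u * t ≤ _
    rw [inner_add_right, inner_smul_right, inner_smul_right]
    exact add_le_add (mul_le_mul_of_nonneg_left hvx hl) (mul_le_mul_of_nonneg_left hvq hu)
  have hnorm : ‖l • x + u • q‖ ^ 2 = l ^ 2 + u ^ 2 + 2 * (l * u) * ⟪x, q⟫ := by
    rw [norm_add_sq_real, norm_smul, norm_smul, hx, hq, real_inner_smul_left, inner_smul_right,
      mul_one, mul_one, Real.norm_eq_abs, Real.norm_eq_abs, sq_abs, sq_abs]
    ring
  refine (measureReal_mono hsub).trans ((gaussVec_inner_ge_le _ _).trans ?_)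
  rw [hnorm]
  gcongr

lemma gaussVec_inner_ge_inner_ge_le (hx : ‖x‖ = 1) (hq : ‖q‖ = 1) (hr : ⟪x, q⟫ ≤ r)
    (hr1 : r ^ 2 < 1) (hM : 0 ≤ M) (hrt : r * t ≤ M) :
    (gaussVec d).real {v | M ≤ ⟪(WithLp.toLp 2 v : Vec d), x⟫ ∧
        t ≤ ⟪(WithLp.toLp 2 v : Vec d), q⟫} ≤
      Real.exp (-(M ^ 2 / 2) - max 0 (t - r * M) ^ 2 / (2 * (1 - r ^ 2))) := by
  have hr1' : 0 < 1 - r ^ 2 := sub_pos.2 hr1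
  rcases le_total (t - r * M) 0 with h | h
  · refine (gaussVec_inner_ge_inner_ge_le_of_multipliers hx hq hr M t hM le_rfl).trans_eq ?_
    rw [max_eq_left h]
    ring_nf
  -- The multipliers that minimise the exponent.
  · refine (gaussVec_inner_ge_inner_ge_le_of_multipliers hx hq hr M t
      (l := (M - r * t) / (1 - r ^ 2)) (u := (t - r * M) / (1 - r ^ 2))
      (div_nonneg (sub_nonneg.2 hrt) hr1'.le) (div_nonneg h hr1'.le)).trans_eq ?_
    rw [max_eq_right h]
    congr 1
    field_simp
    ring

lemma sqrt_two_pi_mul_exp_three_halves_le : √(2 * Real.pi) * Real.exp (3 / 2) ≤ 16 := by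
  have hexp : Real.exp (3 / 2) ^ 2 = Real.exp 1 ^ 3 := by
    rw [← Real.exp_nat_mul, ← Real.exp_nat_mul]
    norm_num
  refine le_of_sq_le_sq ?_ (by norm_num)
  calc (√(2 * Real.pi) * Real.exp (3 / 2)) ^ 2
      = 2 * Real.pi * Real.exp 1 ^ 3 := by
        rw [mul_pow, hexp, Real.sq_sqrt (by positivity)]
    _ ≤ 2 * 3.15 * 2.8 ^ 3 := by
        gcongr
        · exact Real.pi_lt_d2.le
        · exact (Real.exp_one_lt_d9.trans (by norm_num)).le
    _ ≤ 16 ^ 2 := by norm_num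

lemma exp_div_le_gaussianPDFReal (hM : 1 ≤ M) (ht : t ∈ Set.Icc M (M + M⁻¹)) :
    Real.exp (-(M ^ 2 / 2)) / 16 ≤ gaussianPDFReal 0 1 t := by
  have hM0 : 0 < M := one_pos.trans_le hM
  have hsq : t ^ 2 ≤ M ^ 2 + 3 := by
    calc t ^ 2 ≤ (M + M⁻¹) ^ 2 := pow_le_pow_left₀ (hM0.le.trans ht.1) ht.2 2
      _ = M ^ 2 + 2 + M⁻¹ ^ 2 := by field_simp; ring
      _ ≤ M ^ 2 + 2 + 1 := by gcongr; exact pow_le_one₀ (by positivity) (inv_le_one_of_one_le₀ hM)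
      _ = M ^ 2 + 3 := by ring
  simp only [gaussianPDFReal, NNReal.coe_one, mul_one, sub_zero]
  calc Real.exp (-(M ^ 2 / 2)) / 16
      ≤ Real.exp (-(M ^ 2 / 2)) / (√(2 * Real.pi) * Real.exp (3 / 2)) := by
        gcongr
        exact sqrt_two_pi_mul_exp_three_halves_le
    _ = (√(2 * Real.pi))⁻¹ * Real.exp (-(M ^ 2 / 2) - 3 / 2) := by
        rw [Real.exp_sub]
        field_simp
    _ ≤ (√(2 * Real.pi))⁻¹ * Real.exp (-t ^ 2 / 2) := by
        gcongr
        linarith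

lemma exp_div_le_gaussianReal_Ici (hM : 1 ≤ M) :
    Real.exp (-(M ^ 2 / 2)) / (16 * M) ≤ (gaussianReal 0 1).real (Set.Ici M) := by
  have : 0 < M := one_pos.trans_le hM
  have hpdf := setLIntegral_mono_ae (μ := volume) (s := Set.Icc M (M + M⁻¹))
    (f := fun _ => ENNReal.ofReal (Real.exp (-(M ^ 2 / 2)) / 16))
    (measurable_gaussianPDF 0 1).aemeasurable
    (Eventually.of_forall fun t ht => ENNReal.ofReal_le_ofReal (exp_div_le_gaussianPDFReal hM ht))
  rw [setLIntegral_const, Real.volume_Icc, ← gaussianReal_apply 0 one_ne_zero,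
    ← ENNReal.ofReal_mul (by positivity), add_sub_cancel_left] at hpdf
  rw [Measure.real, ← ENNReal.ofReal_le_iff_le_toReal (measure_ne_top _ _), ← div_div,
    div_eq_mul_inv _ M]
  exact hpdf.trans (measure_mono Set.Icc_subset_Ici_self)

lemma exp_div_le_gaussVec_inner_ge (hx : ‖x‖ = 1) (hM : 1 ≤ M) :
    Real.exp (-(M ^ 2 / 2)) / (16 * M) ≤
      (gaussVec d).real {v | M ≤ ⟪(WithLp.toLp 2 v : Vec d), x⟫} := by
  have hmap := map_inner_gaussVec x
  rw [hx, one_pow, Real.toNNReal_one] at hmap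
  have hM' := exp_div_le_gaussianReal_Ici hM
  rwa [← hmap, map_measureReal_apply (measurable_inner_toLp x) measurableSet_Ici] at hM'

lemma gaussFilters_real_eval (i : Fin m) {s : Set (Fin d → ℝ)} (hs : MeasurableSet s) :
    (gaussFilters d m).real {g | g i ∈ s} = (gaussVec d).real s :=
  (measurePreserving_eval (fun _ : Fin m => gaussVec d) i).measureReal_preimage hs.nullMeasurableSet

lemma gaussFilters_max_lt_le (hx : ‖x‖ = 1) (hM : 1 ≤ M) :
    (gaussFilters d m).real {g | ∀ i, ⟪toFilters g i, x⟫ < M} ≤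
      Real.exp (-(m * (Real.exp (-(M ^ 2 / 2)) / (16 * M)))) := by
  have hset : {g : Fin m → Fin d → ℝ | ∀ i, ⟪toFilters g i, x⟫ < M} =
      Set.univ.pi fun _ => {v : Fin d → ℝ | M ≤ ⟪(WithLp.toLp 2 v : Vec d), x⟫}ᶜ := by
    ext g
    simp [toFilters]
  have hms : MeasurableSet {v : Fin d → ℝ | M ≤ ⟪(WithLp.toLp 2 v : Vec d), x⟫} :=
    measurable_inner_toLp x measurableSet_Ici
  rw [hset, Measure.real, Measure.pi_pi, Finset.prod_const, Finset.card_univ, Fintype.card_fin,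
    ENNReal.toReal_pow, ← Measure.real, probReal_compl_eq_one_sub hms, neg_mul_eq_mul_neg,
    Real.exp_nat_mul]
  gcongr
  · exact sub_nonneg.2 measureReal_le_one
  · exact (sub_le_sub_left (exp_div_le_gaussVec_inner_ge hx hM) 1).trans
      (Real.one_sub_le_exp_neg _)

/-- Either no filter reaches level `M` at `x`, or some filter reaches both `M` at `x` and `t` at
`q`. -/
lemma gaussFilters_reaches_le (hx : ‖x‖ = 1) (hq : ‖q‖ = 1) (hr : ⟪x, q⟫ ≤ r)
    (hr1 : r ^ 2 < 1) (hM : 1 ≤ M) (hrt : r * t ≤ M) :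
    (gaussFilters d m).real {g | Reaches (toFilters g) x q t} ≤
      Real.exp (-(m * (Real.exp (-(M ^ 2 / 2)) / (16 * M)))) +
      m * Real.exp (-(M ^ 2 / 2) - max 0 (t - r * M) ^ 2 / (2 * (1 - r ^ 2))) := by
  set both : Set (Fin d → ℝ) := {v | M ≤ ⟪(WithLp.toLp 2 v : Vec d), x⟫ ∧
    t ≤ ⟪(WithLp.toLp 2 v : Vec d), q⟫}
  have hboth : MeasurableSet both :=
    (measurable_inner_toLp x measurableSet_Ici).inter (measurable_inner_toLp q measurableSet_Ici)
  have hsub : {g : Fin m → Fin d → ℝ | Reaches (toFilters g) x q t} ⊆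
      {g | ∀ i, ⟪toFilters g i, x⟫ < M} ∪ ⋃ i, {g | g i ∈ both} := by
    rintro g ⟨i, hi, ht⟩
    by_cases! h : ∀ i, ⟪toFilters g i, x⟫ < M
    · exact Or.inl h
    · obtain ⟨j, hj⟩ := h
      exact Or.inr (Set.mem_iUnion.2 ⟨i, hj.trans (hi.1 j), ht⟩)
  have hunion : (gaussFilters d m).real (⋃ i, {g | g i ∈ both}) ≤
      m * Real.exp (-(M ^ 2 / 2) - max 0 (t - r * M) ^ 2 / (2 * (1 - r ^ 2))) := by
    have hi : ∀ i ∈ Finset.univ, (gaussFilters d m).real {g | g i ∈ both} ≤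
        Real.exp (-(M ^ 2 / 2) - max 0 (t - r * M) ^ 2 / (2 * (1 - r ^ 2))) := fun i _ =>
      (gaussFilters_real_eval i hboth).trans_le
        (gaussVec_inner_ge_inner_ge_le hx hq hr hr1 (zero_le_one.trans hM) hrt)
    refine (measureReal_iUnion_fintype_le _).trans
      ((Finset.sum_le_card_nsmul _ _ _ hi).trans_eq ?_)
    rw [Finset.card_univ, Fintype.card_fin, nsmul_eq_mul]
  exact (measureReal_mono hsub).trans
    ((measureReal_union_le _ _).trans (add_le_add (gaussFilters_max_lt_le hx hM) hunion))

lemma gaussFilters_inner_ge_le (hq : ‖q‖ = 1) (t : ℝ) (i : Fin m) :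
    (gaussFilters d m).real {g | t ≤ ⟪toFilters g i, q⟫} ≤ Real.exp (-(max 0 t ^ 2 / 2)) := by
  refine (gaussFilters_real_eval i
    (measurable_inner_toLp q (measurableSet_Ici (a := t)))).trans_le ?_
  rcases le_total t 0 with ht | ht
  · rw [max_eq_left ht, zero_pow two_ne_zero, zero_div, neg_zero, Real.exp_zero]
    exact measureReal_le_one
  · have hsub : (fun v => ⟪(WithLp.toLp 2 v : Vec d), q⟫) ⁻¹' Set.Ici t ⊆
        {v | t * t ≤ ⟪(WithLp.toLp 2 v : Vec d), t • q⟫} := fun v hv => by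
      change t * t ≤ ⟪(WithLp.toLp 2 v : Vec d), t • q⟫
      rw [inner_smul_right]
      exact mul_le_mul_of_nonneg_left hv ht
    refine (measureReal_mono hsub).trans ((gaussVec_inner_ge_le _ _).trans_eq ?_)
    rw [norm_smul, hq, mul_one, Real.norm_eq_abs, sq_abs, max_eq_right ht]
    ring_nf

end GaussianFilters

/-! ### The query answer for given draws -/

lemma exists_eq_map_univ {X : Type*} {S : Multiset X} {n : ℕ} (hS : S.card = n) :
    ∃ x : Fin n → X, S = Finset.univ.val.map x := by
  subst hS
  obtain ⟨l, rfl⟩ := Quot.exists_rep S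
  refine ⟨l.get, ?_⟩
  change (l : Multiset X) = Multiset.map l.get (Finset.univ : Finset (Fin l.length)).val
  rw [Fin.univ_val_map, List.ofFn_get]

section QueryBounds

variable {d m n : ℕ} (a : Fin m → Vec d) (x : Fin n → Sph d) (q : Sph d)

open Classical in
lemma bucketCount_map (i : Fin m) :
    bucketCount a (Finset.univ.val.map x) i =
      (Finset.univ.filter fun k => IsArgmax a (x k : Vec d) i).card := by
  rw [bucketCount_eq, Multiset.map_map, Multiset.filter_map, Multiset.card_map]
  rfl

open Classical in
lemma ballCount_map (r : ℝ) :
    ballCount (Finset.univ.val.map x) q r =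
      (Finset.univ.filter fun k => r ≤ ⟪(q : Vec d), (x k : Vec d)⟫).card := by
  unfold ballCount
  simp only [Multiset.pure_def, Multiset.bind_def, Multiset.bind_singleton]
  rw [Multiset.map_map, Multiset.filter_map, Multiset.card_map]
  rfl

open Classical in
lemma sum_bucketCount_eq_card_reaches (t : ℝ) :
    ∑ i with t ≤ ⟪a i, (q : Vec d)⟫, bucketCount a (Finset.univ.val.map x) i =
      (Finset.univ.filter fun k => Reaches a (x k : Vec d) q t).card := by
  simp only [bucketCount_map, Finset.card_filter]
  rw [Finset.sum_comm]
  refine Finset.sum_congr rfl fun k _ => ?_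
  split_ifs with h
  · obtain ⟨i, hi, hq⟩ := h
    rw [Finset.sum_eq_single_of_mem i (by simpa using hq), if_pos hi]
    exact fun j _ hj => if_neg fun hj' => hj (hj'.unique hi)
  · exact Finset.sum_eq_zero fun i hi =>
      if_neg fun h' => h ⟨i, h', (Finset.mem_filter.1 hi).2⟩

open Classical in
lemma sum_bucketCount_le_ballCount_add (t β : ℝ) :
    ∑ i with t ≤ ⟪a i, (q : Vec d)⟫, bucketCount a (Finset.univ.val.map x) i ≤
      ballCount (Finset.univ.val.map x) q β +
        ((Finset.univ.filter fun k => ¬ β ≤ ⟪(q : Vec d), (x k : Vec d)⟫).filter fun k =>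
          Reaches a (x k : Vec d) q t).card := by
  rw [sum_bucketCount_eq_card_reaches, ballCount_map]
  refine le_trans (Finset.card_le_card fun k hk => ?_) (Finset.card_union_le _ _)
  by_cases h : β ≤ ⟪(q : Vec d), (x k : Vec d)⟫
  · exact Finset.mem_union_left _ (by simpa using h)
  · exact Finset.mem_union_right _ (Finset.mem_filter.2 ⟨by simpa using h, by simpa using hk⟩)

open Classical in
/-- A point whose filter is not queried at `q` with threshold `t` reaches `-q` with threshold `-t`,
so that missed points are subject to the same probability estimate as found points. -/
lemma ballCount_le_sum_bucketCount_add (hm : 0 < m) (t α : ℝ) :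
    ballCount (Finset.univ.val.map x) q α ≤
      ∑ i with t ≤ ⟪a i, (q : Vec d)⟫, bucketCount a (Finset.univ.val.map x) i +
        ((Finset.univ.filter fun k => α ≤ ⟪(q : Vec d), (x k : Vec d)⟫).filter fun k =>
          Reaches a (x k : Vec d) (-q) (-t)).card := by
  rw [sum_bucketCount_eq_card_reaches, ballCount_map]
  refine le_trans (Finset.card_le_card fun k hk => ?_) (Finset.card_union_le _ _)
  obtain ⟨i, hi⟩ := exists_isArgmax hm a (x k : Vec d)
  by_cases h : t ≤ ⟪a i, (q : Vec d)⟫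
  · exact Finset.mem_union_left _ (by simpa using ⟨i, hi, h⟩)
  · refine Finset.mem_union_right _ (Finset.mem_filter.2 ⟨hk, i, hi, ?_⟩)
    rw [inner_neg_right]
    linarith

end QueryBounds

section Build

variable {d n : ℕ} {α β ε δ : ℝ} {g : Fin (numFilters n α β) → Fin d → ℝ}
  {z : Fin (numFilters n α β) → ℝ}

open Classical in
lemma abs_query_build_sub_le (hz : ∀ i, |z i| ≤ tlapRadius 1 ε δ) (S : Multiset (Sph d))
    (q : Sph d) :
    |(build n α β ε δ S g z).query q -
      (∑ i with threshold (numFilters n α β) α ≤ ⟪toFilters g i, (q : Vec d)⟫,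
        bucketCount (toFilters g) S i : ℕ)| ≤
      (Finset.univ.filter fun i =>
        threshold (numFilters n α β) α ≤ ⟪toFilters g i, (q : Vec d)⟫).card *
          (2 * tlapRadius 1 ε δ) := by
  have hquery : (build n α β ε δ S g z).query q =
      ∑ i with threshold (numFilters n α β) α ≤ ⟪toFilters g i, (q : Vec d)⟫,
        (build n α β ε δ S g z).table i := rfl
  have htable : ∀ i, (build n α β ε δ S g z).table i =
    if (bucketCount (toFilters g) S i : ℝ) + z i ≤ tlapRadius 1 ε δ then 0
    else (bucketCount (toFilters g) S i : ℝ) + z i := fun _ => rfl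
  rw [hquery, Nat.cast_sum, ← Finset.sum_sub_distrib, ← nsmul_eq_mul]
  refine (Finset.abs_sum_le_sum_abs _ _).trans (Finset.sum_le_card_nsmul _ _ _ fun i _ => ?_)
  obtain ⟨hz₁, hz₂⟩ := abs_le.1 (hz i)
  rw [htable, abs_le]
  split_ifs <;> constructor <;>
    linarith [(Nat.cast_nonneg _ : (0 : ℝ) ≤ bucketCount (toFilters g) S i)]

open Classical in
lemma query_build_bounds (hz : ∀ i, |z i| ≤ tlapRadius 1 ε δ) (hm : 0 < numFilters n α β)
    (x : Fin n → Sph d) (q : Sph d) {Q N F : ℝ}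
    (hQ : ((Finset.univ.filter fun i =>
      threshold (numFilters n α β) α ≤ ⟪toFilters g i, (q : Vec d)⟫).card : ℝ) ≤ Q)
    (hN : (((Finset.univ.filter fun k => α ≤ ⟪(q : Vec d), (x k : Vec d)⟫).filter fun k =>
      Reaches (toFilters g) (x k) (-q) (-threshold (numFilters n α β) α)).card : ℝ) ≤ N)
    (hF : (((Finset.univ.filter fun k => ¬ β ≤ ⟪(q : Vec d), (x k : Vec d)⟫).filter fun k =>
      Reaches (toFilters g) (x k) q (threshold (numFilters n α β) α)).card : ℝ) ≤ F) :
    (ballCount (Finset.univ.val.map x) q α : ℝ) - N - Q * (2 * tlapRadius 1 ε δ) ≤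
        (build n α β ε δ (Finset.univ.val.map x) g z).query q ∧
      (build n α β ε δ (Finset.univ.val.map x) g z).query q ≤
        (ballCount (Finset.univ.val.map x) q β : ℝ) + F + Q * (2 * tlapRadius 1 ε δ) := by
  have hA : 0 ≤ tlapRadius 1 ε δ := (abs_nonneg _).trans (hz ⟨0, hm⟩)
  obtain ⟨hlow, hupp⟩ := abs_le.1 ((abs_query_build_sub_le hz (Finset.univ.val.map x) q).trans
    (mul_le_mul_of_nonneg_right hQ (mul_nonneg zero_le_two hA)))
  have hfound : (_ : ℝ) ≤ _ := Nat.cast_le.2 <|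
    sum_bucketCount_le_ballCount_add (toFilters g) x q (threshold (numFilters n α β) α) β
  have hmissed : (_ : ℝ) ≤ _ := Nat.cast_le.2 <|
    ballCount_le_sum_bucketCount_add (toFilters g) x q hm (threshold (numFilters n α β) α) α
  rw [Nat.cast_add] at hfound hmissed
  constructor <;> linarith

end Build

/-! ### Accuracy from bounds on single events -/

open Classical in
/-- Markov's inequality for the number of events that occur. -/
lemma exists_measureReal_le_forall_card_filter_le {Ω ι : Type*} [MeasurableSpace Ω]
    {μ : Measure Ω} [IsFiniteMeasure μ] {s : Finset ι} {E : ι → Set Ω}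
    (hE : ∀ k ∈ s, MeasurableSet (E k)) {p : ℝ} (hp : 0 < p) (hμ : ∀ k ∈ s, μ.real (E k) ≤ p)
    {K : ℝ} (hK : 0 < K) :
    ∃ B : Set Ω, μ.real B ≤ 1 / K ∧
      ∀ ω ∉ B, ((s.filter fun k => ω ∈ E k).card : ℝ) ≤ K * (s.card * p) := by
  rcases s.eq_empty_or_nonempty with rfl | hs
  · exact ⟨∅, by simpa using hK.le, fun _ _ => by simp⟩
  set f : Ω → ℝ := fun ω => ∑ k ∈ s, (E k).indicator 1 ω
  have hf : ∀ ω, f ω = (s.filter fun k => ω ∈ E k).card := fun ω => by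
    simp only [f, Finset.card_filter, Nat.cast_sum, Nat.cast_ite, Nat.cast_one, Nat.cast_zero,
      Set.indicator_apply, Pi.one_apply]
  have hindicator : ∀ k ∈ s, Integrable ((E k).indicator (1 : Ω → ℝ)) μ := fun k hk =>
    (integrable_const (1 : ℝ)).indicator (hE k hk)
  have hmean : ∫ ω, f ω ∂μ ≤ s.card * p := by
    rw [integral_finsetSum _ hindicator, ← nsmul_eq_mul]
    refine Finset.sum_le_card_nsmul _ _ _ fun k hk => ?_
    rw [integral_indicator_one (hE k hk)]
    exact hμ k hk
  have hmarkov := (mul_meas_ge_le_integral_of_nonneg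
    (Eventually.of_forall fun ω => (Nat.cast_nonneg _).trans_eq (hf ω).symm)
    (integrable_finsetSum _ hindicator) (K * (s.card * p))).trans hmean
  refine ⟨{ω | K * (s.card * p) ≤ f ω}, ?_, fun ω hω => (hf ω).symm.le.trans (not_le.1 hω).le⟩
  rw [le_div_iff₀ hK]
  exact le_of_mul_le_mul_left (by linarith) (mul_pos (Nat.cast_pos.2 hs.card_pos) hp)

lemma ae_drawLaw_abs_le (d m : ℕ) {ε δ : ℝ} (hε : 0 < ε) (hδ : 0 < δ) (hδ' : δ ≤ 1 / 2) :
    ∀ᵐ ω ∂drawLaw d m ε δ, ∀ i, |ω.2 i| ≤ tlapRadius 1 ε δ := by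
  have := isProbabilityMeasure_tlap one_pos hε hδ hδ'
  refine ae_all_iff.2 fun i => ?_
  have hnoise : MeasurePreserving (fun ω : (Fin m → Fin d → ℝ) × (Fin m → ℝ) => ω.2 i)
      (drawLaw d m ε δ) (tlap 1 ε δ) :=
    (measurePreserving_eval (fun _ : Fin m => tlap 1 ε δ) i).comp measurePreserving_snd
  exact hnoise.quasiMeasurePreserving.ae ae_tlap_abs_le

lemma one_sub_le_construction {d n : ℕ} {α β ε δ : ℝ} (hε : 0 < ε) (hδ : 0 < δ)
    (hδ' : δ ≤ 1 / 2) {S : Multiset (Sph d)} {B : Set (Fin (numFilters n α β) → Fin d → ℝ)}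
    {Y : Set (Data d (numFilters n α β))}
    (hY : ∀ g ∉ B, ∀ z, (∀ i, |z i| ≤ tlapRadius 1 ε δ) → build n α β ε δ S g z ∈ Y) :
    1 - gaussFilters d (numFilters n α β) B ≤ construction n α β ε δ S Y := by
  have := isProbabilityMeasure_tlap one_pos hε hδ hδ'
  have hprob := isProbabilityMeasure_drawLaw d (numFilters n α β) hε hδ hδ'
  have hB : drawLaw d (numFilters n α β) ε δ (B ×ˢ Set.univ) =
      gaussFilters d (numFilters n α β) B := by
    rw [drawLaw, Measure.prod_prod, measure_univ, mul_one]
  have hcover : (Set.univ : Set ((Fin (numFilters n α β) → Fin d → ℝ) × _)) ≤ᵐ[drawLaw d _ ε δ]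
      ((fun ω => build n α β ε δ S ω.1 ω.2) ⁻¹' Y ∪ B ×ˢ Set.univ : Set _) := by
    filter_upwards [ae_drawLaw_abs_le d (numFilters n α β) hε hδ hδ'] with ω hω _
    by_cases hg : ω.1 ∈ B
    · exact Or.inr ⟨hg, Set.mem_univ _⟩
    · exact Or.inl (hY ω.1 hg ω.2 hω)
  rw [tsub_le_iff_right, ← hB, ← measure_univ (μ := drawLaw d (numFilters n α β) ε δ)]
  refine (measure_mono_ae hcover).trans ((measure_union_le _ _).trans ?_)
  gcongr
  exact Measure.le_map_apply (measurable_build n α β ε δ S).aemeasurable Y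

lemma construction_accuracy {d n : ℕ} {α β ε δ : ℝ} (hε : 0 < ε) (hδ : 0 < δ)
    (hδ' : δ ≤ 1 / 2) (hm : 0 < numFilters n α β) (x : Fin n → Sph d) (q : Sph d)
    {pQ pN pF : ℝ} (hpQ0 : 0 < pQ) (hpN0 : 0 < pN) (hpF0 : 0 < pF)
    (hpQ : ∀ i, (gaussFilters d (numFilters n α β)).real
      {g | threshold (numFilters n α β) α ≤ ⟪toFilters g i, (q : Vec d)⟫} ≤ pQ)
    (hpN : ∀ k, α ≤ ⟪(q : Vec d), (x k : Vec d)⟫ → (gaussFilters d (numFilters n α β)).real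
      {g | Reaches (toFilters g) (x k) (-q) (-threshold (numFilters n α β) α)} ≤ pN)
    (hpF : ∀ k, ⟪(q : Vec d), (x k : Vec d)⟫ < β → (gaussFilters d (numFilters n α β)).real
      {g | Reaches (toFilters g) (x k) q (threshold (numFilters n α β) α)} ≤ pF) :
    2 / 3 ≤ construction n α β ε δ (Finset.univ.val.map x)
      {D | (1 - 9 * pN) * (ballCount (Finset.univ.val.map x) q α : ℝ) -
            9 * (numFilters n α β * pQ) * (2 * tlapRadius 1 ε δ) ≤ D.query q ∧
          D.query q ≤ (ballCount (Finset.univ.val.map x) q β : ℝ) + 9 * (n * pF) +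
            9 * (numFilters n α β * pQ) * (2 * tlapRadius 1 ε δ)} := by
  classical
  set η := threshold (numFilters n α β) α
  set μ := gaussFilters d (numFilters n α β)
  set sN := Finset.univ.filter fun k => α ≤ ⟪(q : Vec d), (x k : Vec d)⟫ with hsN
  set sF := Finset.univ.filter fun k => ¬ β ≤ ⟪(q : Vec d), (x k : Vec d)⟫
  have h9 : (0 : ℝ) < 9 := by norm_num
  obtain ⟨BQ, hBQ, hQ⟩ := exists_measureReal_le_forall_card_filter_le (s := Finset.univ)
    (fun i _ => measurable_inner_toFilters (q : Vec d) i (measurableSet_Ici (a := η)))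
    hpQ0 (fun i _ => hpQ i) h9
  obtain ⟨BN, hBN, hN⟩ := exists_measureReal_le_forall_card_filter_le (s := sN)
    (fun k _ => measurableSet_reaches (x k : Vec d) (-q : Vec d) (-η))
    hpN0 (fun k hk => hpN k (Finset.mem_filter.1 hk).2) h9
  obtain ⟨BF, hBF, hF⟩ := exists_measureReal_le_forall_card_filter_le (s := sF)
    (fun k _ => measurableSet_reaches (x k : Vec d) (q : Vec d) η)
    hpF0 (fun k hk => hpF k (not_le.1 (Finset.mem_filter.1 hk).2)) h9
  have hB : μ (BQ ∪ BN ∪ BF) ≤ ENNReal.ofReal (1 / 3) := by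
    rw [← ofReal_measureReal]
    refine ENNReal.ofReal_le_ofReal ?_
    linarith [measureReal_union_le (μ := μ) (BQ ∪ BN) BF, measureReal_union_le (μ := μ) BQ BN]
  have h23 : (2 / 3 : ℝ≥0∞) = 1 - ENNReal.ofReal (1 / 3) := by
    rw [← ENNReal.ofReal_one, ← ENNReal.ofReal_sub _ (by norm_num)]
    norm_num [ENNReal.ofReal_div_of_pos]
  rw [h23]
  refine (tsub_le_tsub_left hB 1).trans (one_sub_le_construction hε hδ hδ' fun g hg z hz => ?_)
  simp only [Set.mem_union, not_or] at hg
  have hcardQ := hQ g hg.1.1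
  rw [Finset.card_univ, Fintype.card_fin] at hcardQ
  have hcardN := hN g hg.1.2
  rw [hsN, ← ballCount_map] at hcardN
  have hcardF : _ ≤ 9 * (n * pF) := (hF g hg.2).trans <| by
    gcongr
    exact (Finset.card_le_univ sF).trans_eq (Fintype.card_fin n)
  obtain ⟨hlow, hupp⟩ := query_build_bounds hz hm x q hcardQ hcardN hcardF
  exact ⟨by linarith, hupp⟩

/-! ### Levels of the Gaussian maximum -/

/-- The level `√(2 (l - k log l))`; for `l = log m`, the maximum of `m` standard Gaussian variables
exceeds it with probability close to `1` when `k > 1 / 2`. -/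
def level (l k : ℝ) : ℝ := √(2 * (l - k * Real.log l))

/-- The relative error `√(log l / ((1 - α²) l))`, which tends to `0` under the second growth
condition when `l = log m`. -/
def slack (α l : ℝ) : ℝ := √(Real.log l / ((1 - α ^ 2) * l))

section Levels

variable {α β l k : ℝ}

lemma slack_nonneg : 0 ≤ slack α l := Real.sqrt_nonneg _

lemma one_sub_sq_mul_slack_sq (hα : α ^ 2 < 1) (hl : 1 ≤ l) :
    (1 - α ^ 2) * l * slack α l ^ 2 = Real.log l := by
  have hαl : 0 < (1 - α ^ 2) * l := mul_pos (sub_pos.2 hα) (one_pos.trans_le hl)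
  rw [slack, Real.sq_sqrt (div_nonneg (Real.log_nonneg hl) hαl.le), mul_div_cancel₀ _ hαl.ne']

lemma threshold_eq {m : ℕ} (hα : α ^ 2 < 1) (hm : 1 ≤ Real.log m) :
    threshold m α =
      √(2 * Real.log m) * (α - (1 - α ^ 2) * slack α (Real.log m)) := by
  have hα' : 0 ≤ 1 - α ^ 2 := (sub_pos.2 hα).le
  have hsqrt : √(2 * (1 - α ^ 2) * Real.log (Real.log m)) =
      √(2 * Real.log m) * ((1 - α ^ 2) * slack α (Real.log m)) := by
    rw [← one_sub_sq_mul_slack_sq hα hm, ← Real.sqrt_sq (mul_nonneg hα' slack_nonneg),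
      ← Real.sqrt_mul (by linarith)]
    ring_nf
  rw [threshold, hsqrt]
  ring

lemma log_le_of_slack_le (hα : α ^ 2 < 1) (hl : 1 ≤ l) (hs : slack α l ≤ 1 / 12) :
    144 * Real.log l ≤ l := by
  have hs2 : slack α l ^ 2 ≤ (1 / 12) ^ 2 := pow_le_pow_left₀ slack_nonneg hs 2
  have hαl : (1 - α ^ 2) * l ≤ l := mul_le_of_le_one_left (by linarith) (by nlinarith)
  rw [← one_sub_sq_mul_slack_sq hα hl]
  nlinarith

lemma level_sq_div_two (hl : 1 ≤ l) (hlog : 144 * Real.log l ≤ l) (hk : k ≤ 2) :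
    level l k ^ 2 / 2 = l - k * Real.log l := by
  have hlog0 : 0 ≤ Real.log l := Real.log_nonneg hl
  rw [level, Real.sq_sqrt (by nlinarith)]
  ring

lemma one_le_level (hl : 1 ≤ l) (hlog : 144 * Real.log l ≤ l) (hk : k ≤ 2) : 1 ≤ level l k := by
  have hlog0 : 0 ≤ Real.log l := Real.log_nonneg hl
  rw [level, Real.one_le_sqrt]
  nlinarith

lemma level_le_sqrt (hl : 1 ≤ l) (hk : 0 ≤ k) : level l k ≤ √(2 * l) := by
  have hlog0 : 0 ≤ Real.log l := Real.log_nonneg hl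
  exact Real.sqrt_le_sqrt (by nlinarith)

lemma sqrt_mul_le_level (hα : α ^ 2 < 1) (hl : 1 ≤ l) (hs : slack α l ≤ 1 / 12) (hk0 : 0 ≤ k)
    (hk : k ≤ 2) : √(2 * l) * (1 - k * ((1 - α ^ 2) * slack α l ^ 2)) ≤ level l k := by
  set y := 1 - k * ((1 - α ^ 2) * slack α l ^ 2)
  have hfactor : 2 * (l - k * Real.log l) = 2 * l * y := by
    rw [← one_sub_sq_mul_slack_sq hα hl]
    ring
  have hlog := log_le_of_slack_le hα hl hs
  have hy1 : y ≤ 1 := sub_le_self _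
    (mul_nonneg hk0 (mul_nonneg (sub_pos.2 hα).le (sq_nonneg _)))
  have hy0 : 0 ≤ y := by
    refine nonneg_of_mul_nonneg_right (hfactor ▸ ?_ : 0 ≤ 2 * l * y) (by linarith)
    nlinarith [Real.log_nonneg hl]
  rw [level, hfactor, Real.sqrt_mul (by linarith : 0 ≤ 2 * l) y]
  exact mul_le_mul_of_nonneg_left
    (Real.le_sqrt_of_sq_le (pow_le_of_le_one hy0 hy1 two_ne_zero)) (Real.sqrt_nonneg _)

lemma sqrt_mul_le_mul_level_sub (hα0 : 0 ≤ α) (hα : α < 1) (hl : 1 ≤ l) (hs : slack α l ≤ 1 / 12)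
    (hk0 : 0 ≤ k) (hk : k ≤ 2) :
    √(2 * l) * ((1 - α ^ 2) * slack α l) * (1 - k * slack α l) ≤
      α * level l k - √(2 * l) * (α - (1 - α ^ 2) * slack α l) := by
  have hα2 : α ^ 2 < 1 := (sq_lt_one_iff₀ hα0).2 hα
  have hlevel := mul_le_mul_of_nonneg_left (sqrt_mul_le_level hα2 hl hs hk0 hk) hα0
  have hscale : 0 ≤ √(2 * l) * (k * ((1 - α ^ 2) * slack α l ^ 2)) :=
    mul_nonneg (Real.sqrt_nonneg _) (mul_nonneg hk0 (mul_nonneg (sub_pos.2 hα2).le (sq_nonneg _)))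
  nlinarith

lemma mul_sqrt_mul_le_level (hα0 : 0 ≤ α) (hα : α < 1) (hl : 1 ≤ l) (hs : slack α l ≤ 1 / 12)
    (hk0 : 0 ≤ k) (hk : k ≤ 2) (hβ0 : 0 ≤ β) (hβ : β ≤ 1) :
    β * (√(2 * l) * (α - (1 - α ^ 2) * slack α l)) ≤ level l k := by
  have hs0 : 0 ≤ slack α l := slack_nonneg
  have hα2 : 0 ≤ 1 - α ^ 2 := sub_nonneg.2 (pow_le_one₀ hα0 hα.le)
  have hlevel0 : 0 ≤ level l k := Real.sqrt_nonneg _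
  have hgap : 0 ≤ √(2 * l) * ((1 - α ^ 2) * slack α l) * (1 - k * slack α l) :=
    mul_nonneg (mul_nonneg (Real.sqrt_nonneg _) (mul_nonneg hα2 hs0)) (by nlinarith)
  have hle : √(2 * l) * (α - (1 - α ^ 2) * slack α l) ≤ level l k := by
    have := sqrt_mul_le_mul_level_sub hα0 hα hl hs hk0 hk
    have := mul_le_of_le_one_left hlevel0 hα.le
    linarith
  exact (mul_le_mul_of_nonneg_left hle hβ0).trans (mul_le_of_le_one_left hlevel0 hβ)

lemma rpow_div_le_exp_mul (hl : 1 ≤ l) (hlog : 144 * Real.log l ≤ l) (hk0 : 0 ≤ k) (hk : k ≤ 2) :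
    l ^ (k - 1 / 2) / 32 ≤
      Real.exp l * (Real.exp (-(level l k ^ 2 / 2)) / (16 * level l k)) := by
  have hl0 : 0 < l := one_pos.trans_le hl
  have hlevel0 : 0 < level l k := one_pos.trans_le (one_le_level hl hlog hk)
  have hlevel : level l k ≤ 2 * √l := by
    refine (level_le_sqrt hl hk0).trans ?_
    rw [Real.sqrt_mul zero_le_two]
    gcongr
    exact (Real.sqrt_le_left zero_le_two).2 (by norm_num)
  calc l ^ (k - 1 / 2) / 32 = l ^ k / (16 * (2 * √l)) := by
        rw [Real.rpow_sub hl0, ← Real.sqrt_eq_rpow, div_div]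
        ring
    _ ≤ l ^ k / (16 * level l k) := by gcongr
    _ = Real.exp l * (Real.exp (-(level l k ^ 2 / 2)) / (16 * level l k)) := by
        rw [level_sq_div_two hl hlog hk, ← mul_div_assoc, ← Real.exp_add,
          Real.rpow_def_of_pos hl0]
        ring_nf

lemma sq_sub_le_max_sq {u v : ℝ} (hu : 0 ≤ u) : u ^ 2 - 2 * u * v ≤ max 0 (u - v) ^ 2 := by
  rcases le_total (u - v) 0 with h | h
  · rw [max_eq_left h]
    nlinarith
  · rw [max_eq_right h]
    nlinarith [sq_nonneg v]

lemma near_exponent_le (hα0 : 0 ≤ α) (hα : α < 1) (hl : 1 ≤ l) (hs : slack α l ≤ 1 / 12) :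
    l - level l (3 / 4) ^ 2 / 2 -
      max 0 (α * level l (3 / 4) - √(2 * l) * (α - (1 - α ^ 2) * slack α l)) ^ 2 /
        (2 * (1 - α ^ 2)) ≤ -(Real.log l / 8) := by
  have hα2 : α ^ 2 < 1 := (sq_lt_one_iff₀ hα0).2 hα
  have hα2' : 0 < 1 - α ^ 2 := sub_pos.2 hα2
  have hs0 : 0 ≤ slack α l := slack_nonneg
  have hlog0 : 0 ≤ Real.log l := Real.log_nonneg hl
  have hgap : (√(2 * l) * ((1 - α ^ 2) * slack α l) * (1 - 3 / 4 * slack α l)) ^ 2 ≤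
      max 0 (α * level l (3 / 4) - √(2 * l) * (α - (1 - α ^ 2) * slack α l)) ^ 2 :=
    pow_le_pow_left₀ (mul_nonneg (by positivity) (by linarith))
      ((sqrt_mul_le_mul_level_sub hα0 hα hl hs (by norm_num) (by norm_num)).trans
        (le_max_right _ _)) 2
  have hsq : (√(2 * l) * ((1 - α ^ 2) * slack α l) * (1 - 3 / 4 * slack α l)) ^ 2 =
      Real.log l * (1 - 3 / 4 * slack α l) ^ 2 * (2 * (1 - α ^ 2)) := by
    rw [← one_sub_sq_mul_slack_sq hα2 hl, mul_pow, mul_pow, Real.sq_sqrt (by linarith)]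
    ring
  have hexponent := (le_div_iff₀ (mul_pos two_pos hα2')).2 (hsq.symm.trans_le hgap)
  have hconst : Real.log l * (7 / 8) ≤ Real.log l * (1 - 3 / 4 * slack α l) ^ 2 :=
    mul_le_mul_of_nonneg_left (by nlinarith) hlog0
  rw [level_sq_div_two hl (log_le_of_slack_le hα2 hl hs) (by norm_num)]
  linarith

lemma far_exponent_le (hβ0 : 0 ≤ β) (hβ : β ≤ α) (hα : α < 1) (hl : 1 ≤ l)
    (hs : slack α l ≤ 1 / 12) :
    l - level l 2 ^ 2 / 2 -
      max 0 (√(2 * l) * (α - (1 - α ^ 2) * slack α l) - β * level l 2) ^ 2 / (2 * (1 - β ^ 2)) ≤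
      4 * ((1 - α ^ 2) * l * slack α l) - (α - β) ^ 2 * l / (1 - β ^ 2) := by
  have hα2 : α ^ 2 < 1 := (sq_lt_one_iff₀ (hβ0.trans hβ)).2 hα
  have hβ2 : 0 < 1 - β ^ 2 := by nlinarith
  set L := √(2 * l)
  set E := (1 - α ^ 2) * l * slack α l with hE
  have hL0 : 0 ≤ L := Real.sqrt_nonneg _
  have hL2 : L ^ 2 = 2 * l := Real.sq_sqrt (by linarith)
  have hE0 : 0 ≤ E := mul_nonneg (mul_nonneg (sub_pos.2 hα2).le (by linarith)) slack_nonneg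
  have hgap : ((α - β) * L) ^ 2 - 2 * ((α - β) * L) * (L * ((1 - α ^ 2) * slack α l)) ≤
      max 0 (L * (α - (1 - α ^ 2) * slack α l) - β * level l 2) ^ 2 := by
    refine (sq_sub_le_max_sq (mul_nonneg (sub_nonneg.2 hβ) hL0)).trans ?_
    gcongr ?_ ^ 2
    refine max_le_max le_rfl ?_
    have := mul_le_mul_of_nonneg_left (level_le_sqrt hl zero_le_two) hβ0
    linarith
  have hsq : ((α - β) * L) ^ 2 - 2 * ((α - β) * L) * (L * ((1 - α ^ 2) * slack α l)) =
      2 * (α - β) ^ 2 * l - 4 * (α - β) * E := by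
    rw [hE]
    linear_combination ((α - β) ^ 2 - 2 * (α - β) * ((1 - α ^ 2) * slack α l)) * hL2
  have hexponent : (α - β) ^ 2 * l / (1 - β ^ 2) - 2 * E ≤
      max 0 (L * (α - (1 - α ^ 2) * slack α l) - β * level l 2) ^ 2 / (2 * (1 - β ^ 2)) := by
    have hαβ : (α - β) * E ≤ (1 - β ^ 2) * E := mul_le_mul_of_nonneg_right (by nlinarith) hE0
    rw [div_sub' hβ2.ne', div_le_div_iff₀ hβ2 (by positivity)]
    nlinarith
  have hlog : Real.log l ≤ E := by
    rw [← one_sub_sq_mul_slack_sq hα2 hl, pow_two (slack α l), ← mul_assoc]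
    exact mul_le_of_le_one_right hE0 (by linarith)
  rw [level_sq_div_two hl (log_le_of_slack_le hα2 hl hs) le_rfl]
  linarith

lemma query_exponent_le (hα0 : 0 ≤ α) (hα : α < 1) (hl : 1 ≤ l) :
    l - max 0 (√(2 * l) * (α - (1 - α ^ 2) * slack α l)) ^ 2 / 2 ≤
      (1 - α ^ 2) * l + 2 * ((1 - α ^ 2) * l * slack α l) := by
  have hα2 : 0 ≤ 1 - α ^ 2 := sub_nonneg.2 (pow_le_one₀ hα0 hα.le)
  have hL2 : √(2 * l) ^ 2 = 2 * l := Real.sq_sqrt (by linarith)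
  have hmax := sq_sub_le_max_sq (v := √(2 * l) * ((1 - α ^ 2) * slack α l))
    (mul_nonneg hα0 (Real.sqrt_nonneg (2 * l)))
  have hsq : (α * √(2 * l)) ^ 2 -
      2 * (α * √(2 * l)) * (√(2 * l) * ((1 - α ^ 2) * slack α l)) =
        2 * (α ^ 2 * l) - 4 * (α * ((1 - α ^ 2) * l * slack α l)) := by
    linear_combination (α ^ 2 - 2 * α * ((1 - α ^ 2) * slack α l)) * hL2
  have hα' : α * ((1 - α ^ 2) * l * slack α l) ≤ (1 - α ^ 2) * l * slack α l :=
    mul_le_of_le_one_left (mul_nonneg (mul_nonneg hα2 (by linarith)) slack_nonneg) hα.le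
  rw [mul_comm α √(2 * l), ← mul_sub, mul_comm √(2 * l) α] at hmax
  linarith

end Levels

/-! ### The number of filters -/

section NumFilters

variable {n : ℕ} {α β : ℝ}

lemma one_sub_mul_pos (hβ0 : 0 ≤ β) (hβ : β ≤ α) (hα : α < 1) : 0 < 1 - α * β := by nlinarith

lemma one_le_exponent (hβ0 : 0 ≤ β) (hβ : β ≤ α) (hα : α < 1) :
    1 ≤ (1 - β ^ 2) / (1 - α * β) ^ 2 := by
  rw [one_le_div (pow_pos (one_sub_mul_pos hβ0 hβ hα) 2)]
  have hdiff : 0 ≤ β * (2 * (α - β) + β * (1 - α ^ 2)) :=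
    mul_nonneg hβ0 (add_nonneg (by linarith) (mul_nonneg hβ0 (by nlinarith)))
  linarith

lemma rho_eq : rho α β = (1 - α ^ 2) * ((1 - β ^ 2) / (1 - α * β) ^ 2) := by
  rw [rho, mul_div_assoc]

lemma rho_div (hα : 1 - α ^ 2 ≠ 0) :
    rho α β / (1 - α ^ 2) = (1 - β ^ 2) / (1 - α * β) ^ 2 := by
  rw [rho_eq, mul_div_cancel_left₀ _ hα]

lemma one_sub_rho (hβ0 : 0 ≤ β) (hβ : β ≤ α) (hα : α < 1) :
    1 - rho α β = (α - β) ^ 2 / (1 - β ^ 2) * ((1 - β ^ 2) / (1 - α * β) ^ 2) := by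
  have hαβ := (one_sub_mul_pos hβ0 hβ hα).ne'
  have hβ2 : 1 - β ^ 2 ≠ 0 := by nlinarith
  rw [rho]
  field_simp
  ring

lemma rho_nonneg (hβ0 : 0 ≤ β) (hβ : β ≤ α) (hα : α < 1) : 0 ≤ rho α β :=
  div_nonneg (mul_nonneg (by nlinarith) (by nlinarith)) (sq_nonneg _)

lemma rho_le_one (hβ0 : 0 ≤ β) (hβ : β ≤ α) (hα : α < 1) : rho α β ≤ 1 := by
  have hβ2 : 0 < 1 - β ^ 2 := by nlinarith
  rw [← sub_nonneg, one_sub_rho hβ0 hβ hα]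
  positivity

lemma le_numFilters : (n : ℝ) ^ ((1 - β ^ 2) / (1 - α * β) ^ 2) ≤ numFilters n α β :=
  Nat.le_ceil _

lemma numFilters_le (hn : 1 ≤ n) (hβ0 : 0 ≤ β) (hβ : β ≤ α) (hα : α < 1) :
    (numFilters n α β : ℝ) ≤ 2 * (n : ℝ) ^ ((1 - β ^ 2) / (1 - α * β) ^ 2) := by
  have hone : 1 ≤ (n : ℝ) ^ ((1 - β ^ 2) / (1 - α * β) ^ 2) :=
    Real.one_le_rpow (Nat.one_le_cast.2 hn) (zero_le_one.trans (one_le_exponent hβ0 hβ hα))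
  have hceil := (Nat.ceil_lt_add_one (zero_le_one.trans hone)).le
  unfold numFilters
  linarith

lemma self_le_numFilters (hn : 1 ≤ n) (hβ0 : 0 ≤ β) (hβ : β ≤ α) (hα : α < 1) :
    n ≤ numFilters n α β :=
  Nat.cast_le.1 <| (Real.self_le_rpow_of_one_le (Nat.one_le_cast.2 hn)
    (one_le_exponent hβ0 hβ hα)).trans le_numFilters

lemma numFilters_pos (hn : 1 ≤ n) (hβ0 : 0 ≤ β) (hβ : β ≤ α) (hα : α < 1) :
    0 < numFilters n α β :=
  hn.trans (self_le_numFilters hn hβ0 hβ hα)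

lemma le_log_numFilters (hn : 1 ≤ n) :
    (1 - β ^ 2) / (1 - α * β) ^ 2 * Real.log n ≤ Real.log (numFilters n α β) := by
  have hn0 : (0 : ℝ) < n := Nat.cast_pos.2 hn
  rw [← Real.log_rpow hn0]
  exact Real.log_le_log (Real.rpow_pos_of_pos hn0 _) le_numFilters

lemma log_numFilters_le (hn : 1 ≤ n) (hβ0 : 0 ≤ β) (hβ : β ≤ α) (hα : α < 1) :
    Real.log (numFilters n α β) ≤ (1 - β ^ 2) / (1 - α * β) ^ 2 * Real.log n + Real.log 2 := by
  have hn0 : (0 : ℝ) < n := Nat.cast_pos.2 hn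
  rw [← Real.log_rpow hn0, add_comm, ← Real.log_mul two_ne_zero (Real.rpow_pos_of_pos hn0 _).ne']
  exact Real.log_le_log (Nat.cast_pos.2 (numFilters_pos hn hβ0 hβ hα))
    (numFilters_le hn hβ0 hβ hα)

end NumFilters

/-! ### Accuracy -/

/-- An upper bound, as a function of `l = log m`, for the probability that a point in the inner cap
of a query is assigned to a filter that the query does not read. -/
def missProb (l : ℝ) : ℝ := Real.exp (-(l ^ (1 / 4 : ℝ) / 32)) + Real.exp (-(Real.log l / 8))

lemma missProb_pos (l : ℝ) : 0 < missProb l := add_pos (Real.exp_pos _) (Real.exp_pos _)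

lemma tendsto_missProb : Tendsto missProb atTop (𝓝 0) := by
  have hpow : Tendsto (fun l : ℝ => l ^ (1 / 4 : ℝ) / 32) atTop atTop :=
    (tendsto_rpow_atTop (by norm_num)).atTop_div_const (by norm_num)
  have hlog : Tendsto (fun l : ℝ => Real.log l / 8) atTop atTop :=
    Real.tendsto_log_atTop.atTop_div_const (by norm_num)
  have h := (Real.tendsto_exp_neg_atTop_nhds_zero.comp hpow).add
    (Real.tendsto_exp_neg_atTop_nhds_zero.comp hlog)
  rwa [add_zero] at h

section Accuracy

variable {d n m : ℕ} {α β ε ε₀ δ : ℝ}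

lemma tlapRadius_le (hε : 0 < ε) (hε₀ : ε ≤ ε₀) (hδ : 0 < δ) (hδ' : δ ≤ 1 / 2) :
    tlapRadius 1 ε δ ≤ (ε₀ / Real.log 2 + 1) * (Real.log (1 / δ) / ε) := by
  have hlog2 : 0 < Real.log 2 := Real.log_pos one_lt_two
  have hexp : 1 ≤ Real.exp ε := Real.one_le_exp hε.le
  have harg : 1 + (Real.exp ε - 1) / (2 * δ) ≤ Real.exp ε * (1 / δ) := by
    have hdiff : Real.exp ε * (1 / δ) - (1 + (Real.exp ε - 1) / (2 * δ)) =
        (Real.exp ε + 1 - 2 * δ) / (2 * δ) := by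
      field_simp
      ring
    rw [← sub_nonneg, hdiff]
    exact div_nonneg (by linarith) (by positivity)
  have hlog : Real.log (1 + (Real.exp ε - 1) / (2 * δ)) ≤ ε + Real.log (1 / δ) := by
    have harg0 : 0 ≤ (Real.exp ε - 1) / (2 * δ) := div_nonneg (by linarith) (by positivity)
    refine (Real.log_le_log (by linarith) harg).trans_eq ?_
    rw [Real.log_mul (Real.exp_pos _).ne' (by positivity), Real.log_exp]
  have hlogδ : Real.log 2 ≤ Real.log (1 / δ) :=
    Real.log_le_log two_pos ((le_div_iff₀ hδ).2 (by linarith))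
  have hε₀δ : ε ≤ ε₀ / Real.log 2 * Real.log (1 / δ) :=
    calc ε ≤ ε₀ / Real.log 2 * Real.log 2 := by rwa [div_mul_cancel₀ _ hlog2.ne']
      _ ≤ ε₀ / Real.log 2 * Real.log (1 / δ) :=
        mul_le_mul_of_nonneg_left hlogδ (div_nonneg (hε.le.trans hε₀) hlog2.le)
  rw [tlapRadius, one_div_mul_eq_div, ← mul_div_assoc]
  refine div_le_div_of_nonneg_right ?_ hε.le
  linarith

lemma gaussFilters_reaches_neg_le_missProb (hα0 : 0 ≤ α) (hα : α < 1) (hm : 1 ≤ Real.log m)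
    (hs : slack α (Real.log m) ≤ 1 / 12) {x q : Vec d} (hx : ‖x‖ = 1) (hq : ‖q‖ = 1)
    (hxq : α ≤ ⟪q, x⟫) :
    (gaussFilters d m).real {g | Reaches (toFilters g) x (-q) (-threshold m α)} ≤
      missProb (Real.log m) := by
  have hα2 : α ^ 2 < 1 := (sq_lt_one_iff₀ hα0).2 hα
  have hm0 : (0 : ℝ) < m := Nat.cast_pos.2 (Nat.pos_of_ne_zero (by rintro rfl; norm_num at hm))
  have hlog := log_le_of_slack_le hα2 hm hs
  have hinner : ⟪x, -q⟫ ≤ -α := by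
    rw [inner_neg_right, real_inner_comm]
    exact neg_le_neg hxq
  refine (gaussFilters_reaches_le hx ((norm_neg q).trans hq) hinner (by rwa [neg_sq])
    (one_le_level hm hlog (by norm_num : (3 / 4 : ℝ) ≤ 2)) ?_).trans (add_le_add ?_ ?_)
  · rw [neg_mul_neg, threshold_eq hα2 hm]
    exact mul_sqrt_mul_le_level hα0 hα hm hs (by norm_num) (by norm_num) hα0 hα.le
  · refine Real.exp_le_exp.2 (neg_le_neg ?_)
    have h := rpow_div_le_exp_mul hm hlog (by norm_num : (0 : ℝ) ≤ 3 / 4) (by norm_num)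
    rwa [Real.exp_log hm0, show (3 / 4 - 1 / 2 : ℝ) = 1 / 4 by norm_num] at h
  · have h := Real.exp_le_exp.2 (near_exponent_le hα0 hα hm hs)
    rw [sub_sub, sub_eq_add_neg, Real.exp_add, Real.exp_log hm0, neg_add'] at h
    rwa [neg_sq, neg_mul, neg_sub_neg, threshold_eq hα2 hm]

lemma gaussFilters_reaches_le_of_inner_lt (hβ0 : 0 ≤ β) (hβ : β ≤ α) (hα : α < 1)
    (hm : 1024 ≤ Real.log m) (hs : slack α (Real.log m) ≤ 1 / 12) {x q : Vec d} (hx : ‖x‖ = 1)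
    (hq : ‖q‖ = 1) (hxq : ⟪q, x⟫ < β) :
    (gaussFilters d m).real {g | Reaches (toFilters g) x q (threshold m α)} ≤
      Real.exp (-Real.log m) + Real.exp (4 * ((1 - α ^ 2) * Real.log m * slack α (Real.log m)) -
        (α - β) ^ 2 * Real.log m / (1 - β ^ 2)) := by
  have hα0 : 0 ≤ α := hβ0.trans hβ
  have hα2 : α ^ 2 < 1 := (sq_lt_one_iff₀ hα0).2 hα
  have hm1 : 1 ≤ Real.log m := by linarith
  have hm0 : (0 : ℝ) < m := Nat.cast_pos.2 (Nat.pos_of_ne_zero (by rintro rfl; norm_num at hm))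
  have hlog := log_le_of_slack_le hα2 hm1 hs
  have hinner : ⟪x, q⟫ ≤ β := by
    rw [real_inner_comm]
    exact hxq.le
  refine (gaussFilters_reaches_le hx hq hinner ((sq_lt_one_iff₀ hβ0).2 (hβ.trans_lt hα))
    (one_le_level hm1 hlog le_rfl) ?_).trans (add_le_add ?_ ?_)
  · rw [threshold_eq hα2 hm1]
    exact mul_sqrt_mul_le_level hα0 hα hm1 hs zero_le_two le_rfl hβ0 (hβ.trans hα.le)
  · refine Real.exp_le_exp.2 (neg_le_neg ?_)
    have h := rpow_div_le_exp_mul hm1 hlog zero_le_two le_rfl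
    rw [Real.exp_log hm0] at h
    refine le_trans ?_ h
    have hsqrt : 32 ≤ √(Real.log m) := Real.le_sqrt_of_sq_le (by linarith)
    rw [show (2 - 1 / 2 : ℝ) = 1 + 1 / 2 by norm_num, Real.rpow_add (by linarith), Real.rpow_one,
      ← Real.sqrt_eq_rpow, le_div_iff₀ (by norm_num)]
    exact mul_le_mul_of_nonneg_left hsqrt (by linarith)
  · have h := Real.exp_le_exp.2 (far_exponent_le hβ0 hβ hα hm1 hs)
    rw [sub_sub, sub_eq_add_neg, Real.exp_add, Real.exp_log hm0, neg_add'] at h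
    rwa [threshold_eq hα2 hm1]

lemma one_sub_sq_mul_log_numFilters_le (hn : 1 ≤ n) (hβ0 : 0 ≤ β) (hβ : β ≤ α) (hα : α < 1) :
    (1 - α ^ 2) * Real.log (numFilters n α β) ≤ rho α β * Real.log n + Real.log 2 := by
  have hα2 : 0 ≤ 1 - α ^ 2 := sub_nonneg.2 (pow_le_one₀ (hβ0.trans hβ) hα.le)
  calc (1 - α ^ 2) * Real.log (numFilters n α β)
      ≤ (1 - α ^ 2) * ((1 - β ^ 2) / (1 - α * β) ^ 2 * Real.log n + Real.log 2) :=
        mul_le_mul_of_nonneg_left (log_numFilters_le hn hβ0 hβ hα) hα2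
    _ = rho α β * Real.log n + (1 - α ^ 2) * Real.log 2 := by rw [rho_eq]; ring
    _ ≤ rho α β * Real.log n + Real.log 2 := by
        gcongr
        exact mul_le_of_le_one_left (Real.log_nonneg one_le_two) (by linarith [sq_nonneg α])

lemma one_sub_sq_mul_log_numFilters_le_two_mul (hn : 2 ≤ n) (hβ0 : 0 ≤ β) (hβ : β ≤ α)
    (hα : α < 1) : (1 - α ^ 2) * Real.log (numFilters n α β) ≤ 2 * Real.log n := by
  have hlog2 : Real.log 2 ≤ Real.log n := Real.log_le_log two_pos (Nat.ofNat_le_cast.2 hn)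
  have hρ := mul_le_of_le_one_left (Real.log_natCast_nonneg n) (rho_le_one hβ0 hβ hα)
  linarith [one_sub_sq_mul_log_numFilters_le (one_le_two.trans hn) hβ0 hβ hα]

lemma numFilters_mul_exp_threshold_le (hn : 2 ≤ n) (hβ0 : 0 ≤ β) (hβ : β ≤ α) (hα : α < 1)
    (hl : 1 ≤ Real.log (numFilters n α β)) :
    numFilters n α β * Real.exp (-(max 0 (threshold (numFilters n α β) α) ^ 2 / 2)) ≤
      2 * (n : ℝ) ^ (rho α β + 8 * slack α (Real.log (numFilters n α β))) := by
  have hα0 : 0 ≤ α := hβ0.trans hβ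
  have hn1 : 1 ≤ n := one_le_two.trans hn
  have hn0 : (0 : ℝ) < n := Nat.cast_pos.2 hn1
  have hm0 : (0 : ℝ) < numFilters n α β := Nat.cast_pos.2 (numFilters_pos hn1 hβ0 hβ hα)
  have hslack := mul_le_mul_of_nonneg_right
    (one_sub_sq_mul_log_numFilters_le_two_mul hn hβ0 hβ hα)
    (slack_nonneg (α := α) (l := Real.log (numFilters n α β)))
  have hquery := query_exponent_le hα0 hα hl
  have hmain := one_sub_sq_mul_log_numFilters_le hn1 hβ0 hβ hα
  have hlogn : 0 ≤ Real.log n * slack α (Real.log (numFilters n α β)) :=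
    mul_nonneg (Real.log_natCast_nonneg n) slack_nonneg
  rw [threshold_eq ((sq_lt_one_iff₀ hα0).2 hα) hl]
  nth_rewrite 1 [← Real.exp_log hm0]
  rw [← Real.exp_add, Real.rpow_def_of_pos hn0, ← Real.exp_log two_pos, ← Real.exp_add,
    Real.exp_log two_pos, Real.exp_le_exp]
  linarith

lemma mul_exp_neg_add_exp_le (hn : 2 ≤ n) (hβ0 : 0 ≤ β) (hβ : β ≤ α) (hα : α < 1) :
    n * (Real.exp (-Real.log (numFilters n α β)) +
        Real.exp (4 * ((1 - α ^ 2) * Real.log (numFilters n α β) *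
          slack α (Real.log (numFilters n α β))) -
          (α - β) ^ 2 * Real.log (numFilters n α β) / (1 - β ^ 2))) ≤
      2 * (n : ℝ) ^ (rho α β + 8 * slack α (Real.log (numFilters n α β))) := by
  have hn1 : 1 ≤ n := one_le_two.trans hn
  have hn0 : (0 : ℝ) < n := Nat.cast_pos.2 hn1
  have hm0 : (0 : ℝ) < numFilters n α β := Nat.cast_pos.2 (numFilters_pos hn1 hβ0 hβ hα)
  have hβ2 : 0 < 1 - β ^ 2 := by nlinarith
  set l := Real.log (numFilters n α β) with hl
  have hslack := mul_le_mul_of_nonneg_right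
    (one_sub_sq_mul_log_numFilters_le_two_mul hn hβ0 hβ hα) (slack_nonneg (α := α) (l := l))
  have hsep : (1 - rho α β) * Real.log n ≤ (α - β) ^ 2 * l / (1 - β ^ 2) := by
    rw [one_sub_rho hβ0 hβ hα, mul_assoc, mul_div_right_comm]
    exact mul_le_mul_of_nonneg_left (le_log_numFilters hn1) (by positivity)
  have hone : 1 ≤ (n : ℝ) ^ (rho α β + 8 * slack α l) :=
    Real.one_le_rpow (Nat.one_le_cast.2 hn1)
      (add_nonneg (rho_nonneg hβ0 hβ hα) (mul_nonneg (by norm_num) slack_nonneg))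
  have hfirst : (n : ℝ) * Real.exp (-l) ≤ 1 := by
    rw [hl, Real.exp_neg, Real.exp_log hm0, ← div_eq_mul_inv, div_le_one hm0]
    exact Nat.cast_le.2 (self_le_numFilters hn1 hβ0 hβ hα)
  have hsecond : (n : ℝ) * Real.exp (4 * ((1 - α ^ 2) * l * slack α l) -
      (α - β) ^ 2 * l / (1 - β ^ 2)) ≤ (n : ℝ) ^ (rho α β + 8 * slack α l) := by
    nth_rewrite 1 [← Real.exp_log hn0]
    rw [Real.rpow_def_of_pos hn0, ← Real.exp_add, Real.exp_le_exp]
    linarith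
  rw [mul_add]
  linarith

lemma construction_accuracy_of_slack_le (hn : 2 ≤ n) (hβ0 : 0 ≤ β) (hβ : β ≤ α) (hα : α < 1)
    (hl : 1024 ≤ Real.log (numFilters n α β))
    (hs : slack α (Real.log (numFilters n α β)) ≤ 1 / 12)
    (hε : 0 < ε) (hε₀ : ε ≤ ε₀) (hδ : 0 < δ) (hδ' : δ ≤ 1 / 2) {S : Multiset (Sph d)}
    (hS : S.card = n) (q : Sph d) :
    2 / 3 ≤ construction n α β ε δ S
      {D | (1 - 9 * missProb (Real.log (numFilters n α β))) * (ballCount S q α : ℝ) -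
          54 * (ε₀ / Real.log 2 + 1) * (Real.log (1 / δ) / ε *
            (n : ℝ) ^ (rho α β + 8 * slack α (Real.log (numFilters n α β)))) ≤ D.query q ∧
        D.query q ≤ (ballCount S q β : ℝ) +
          54 * (ε₀ / Real.log 2 + 1) * (Real.log (1 / δ) / ε *
            (n : ℝ) ^ (rho α β + 8 * slack α (Real.log (numFilters n α β))))} := by
  obtain ⟨x, rfl⟩ := exists_eq_map_univ hS
  have hα0 : 0 ≤ α := hβ0.trans hβ
  have hl1 : 1 ≤ Real.log (numFilters n α β) := by linarith
  have hq : ‖(q : Vec d)‖ = 1 := norm_eq_of_mem_sphere q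
  have hacc := construction_accuracy hε hδ hδ'
    (numFilters_pos (one_le_two.trans hn) hβ0 hβ hα) x q (Real.exp_pos _) (missProb_pos _)
    (add_pos (Real.exp_pos _) (Real.exp_pos _))
    (fun i => gaussFilters_inner_ge_le hq _ i)
    (fun k hk => gaussFilters_reaches_neg_le_missProb hα0 hα hl1 hs
      (norm_eq_of_mem_sphere (x k)) hq hk)
    (fun k hk => gaussFilters_reaches_le_of_inner_lt hβ0 hβ hα hl hs
      (norm_eq_of_mem_sphere (x k)) hq hk)
  have hread := numFilters_mul_exp_threshold_le hn hβ0 hβ hα hl1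
  have hfar := mul_exp_neg_add_exp_le hn hβ0 hβ hα
  set R := (n : ℝ) ^ (rho α β + 8 * slack α (Real.log (numFilters n α β)))
  set A := tlapRadius 1 ε δ
  have hR0 : 0 ≤ R := Real.rpow_nonneg (Nat.cast_nonneg n) _
  have hA1 : 1 ≤ A := le_tlapRadius one_pos hε hδ hδ'
  have hnoise := mul_le_mul_of_nonneg_right hread (zero_le_one.trans hA1)
  have hRA : R ≤ A * R := le_mul_of_one_le_left hR0 hA1
  have hAR := mul_le_mul_of_nonneg_right (tlapRadius_le hε hε₀ hδ hδ') hR0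
  refine hacc.trans (measure_mono fun D hD => ?_)
  rw [Set.mem_ofPred_eq] at hD ⊢
  exact ⟨by linarith [hD.1], by linarith [hD.2]⟩

end Accuracy

theorem construction_accuracy_eventually {α β : ℕ → ℝ} (hβ0 : ∀ n, 0 ≤ β n)
    (hβ : ∀ n, β n ≤ α n) (hα : ∀ n, α n < 1)
    (h : (fun n : ℕ => Real.log (Real.log (numFilters n (α n) (β n))) /
          Real.log (numFilters n (α n) (β n))) =o[atTop] (fun n => 1 - α n ^ 2)) :
    ∃ e₁ e₂ : ℕ → ℝ, Tendsto e₁ atTop (𝓝 0) ∧ Tendsto e₂ atTop (𝓝 0) ∧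
      ∀ ε₀ : ℝ, 0 < ε₀ → ∃ C : ℝ, 0 < C ∧ ∀ᶠ n : ℕ in atTop,
        ∀ (d : ℕ) (ε δ : ℝ), 0 < ε → ε ≤ ε₀ → 0 < δ → δ < 1 / 2 →
        ∀ (S : Multiset (Sph d)) (q : Sph d), S.card = n →
          2 / 3 ≤ construction n (α n) (β n) ε δ S
            {D | (1 - e₁ n) * (ballCount S q (α n) : ℝ)
                    - C * (Real.log (1 / δ) / ε * (n : ℝ) ^ (rho (α n) (β n) + e₂ n))
                  ≤ D.query q ∧
                D.query q ≤ (ballCount S q (β n) : ℝ)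
                    + C * (Real.log (1 / δ) / ε * (n : ℝ) ^ (rho (α n) (β n) + e₂ n))} := by
  set l : ℕ → ℝ := fun n => Real.log (numFilters n (α n) (β n))
  have hlim : Tendsto l atTop atTop := by
    refine tendsto_atTop_mono' atTop ?_ (Real.tendsto_log_atTop.comp tendsto_natCast_atTop_atTop)
    filter_upwards [eventually_ge_atTop 1] with n hn
    exact Real.log_le_log (Nat.cast_pos.2 hn)
      (Nat.cast_le.2 (self_le_numFilters hn (hβ0 n) (hβ n) (hα n)))
  have hslack : Tendsto (fun n => slack (α n) (l n)) atTop (𝓝 0) := by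
    have hsqrt := (Real.continuous_sqrt.tendsto 0).comp h.tendsto_div_nhds_zero
    rw [Real.sqrt_zero] at hsqrt
    refine hsqrt.congr fun n => ?_
    rw [Function.comp_apply, slack, div_div, mul_comm]
  refine ⟨fun n => 9 * missProb (l n), fun n => 8 * slack (α n) (l n), ?_, ?_, fun ε₀ hε₀ =>
    ⟨54 * (ε₀ / Real.log 2 + 1), ?_, ?_⟩⟩
  · simpa only [mul_zero, Function.comp_apply] using (tendsto_missProb.comp hlim).const_mul 9
  · simpa only [mul_zero] using hslack.const_mul 8
  · have := Real.log_pos one_lt_two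
    positivity
  · filter_upwards [eventually_ge_atTop 2, hlim.eventually_ge_atTop 1024,
      hslack.eventually_le_const (by norm_num : (0 : ℝ) < 1 / 12)] with n hn hln hsn
    intro d ε δ hε hε' hδ hδ' S q hS
    exact construction_accuracy_of_slack_le hn (hβ0 n) (hβ n) (hα n) hln hsn hε hε' hδ hδ'.le
      hS q

/-! ### Time-bounded Hoare triples for RAM programs -/

namespace RAM

attribute [local simp] Instr.exec Instr.Allowed State.setInt State.setReal Test.Holds

/-- A total Hoare triple with a time bound: `p` started in `s` halts after at most `T` steps in a
state satisfying `Q`. -/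
def Ends (E : Env) (K : ℕ) (p : Prog) (s : State) (T : ℕ) (Q : State → Prop) : Prop :=
  ∃ t s', Run E K p s t s' ∧ t ≤ T ∧ Q s'

/-- The straight-line program that executes a list of instructions. -/
def block : List Instr → Prog
  | [] => .skip
  | c :: cs => .seq (.instr c) (block cs)

/-- The weakest precondition of a straight-line program. -/
def blockPre (E : Env) (K : ℕ) : List Instr → (State → Prop) → State → Prop
  | [], Q, s => Q s
  | c :: cs, Q, s => c.Allowed K s ∧ blockPre E K cs Q (c.exec E s)

/-- The loop that runs `p`, which has to increment integer register `i`, until this register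
reaches integer register `j`, after the initialization `cs`. -/
def forLoop (cs : List Instr) (i j : ℕ) (p : Prog) : Prog :=
  .seq (block cs) (.loop (.intLt i j) p)

section Rules

variable {E : Env} {K T T' N i j : ℕ} {b : Test} {cs : List Instr} {p q : Prog} {s : State}
  {Q Q' R : State → Prop} {I : ℕ → State → Prop}

lemma Ends.mono (h : Ends E K p s T Q) (hT : T ≤ T') (hQ : ∀ u, Q u → Q' u) :
    Ends E K p s T' Q' := by
  obtain ⟨t, u, hrun, ht, hu⟩ := h
  exact ⟨t, u, hrun, ht.trans hT, hQ u hu⟩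

lemma Ends.seq (h : Ends E K p s T R) (h' : ∀ u, R u → Ends E K q u T' Q) :
    Ends E K (.seq p q) s (T + T') Q := by
  obtain ⟨t, u, hrun, ht, hu⟩ := h
  obtain ⟨t', v, hrun', ht', hv⟩ := h' u hu
  exact ⟨t + t', v, .seq hrun hrun', add_le_add ht ht', hv⟩

lemma Ends.ite (hp : b.Holds s → Ends E K p s T Q) (hq : ¬ b.Holds s → Ends E K q s T Q) :
    Ends E K (.ite b p q) s (T + 1) Q := by
  by_cases hb : b.Holds s
  · obtain ⟨t, u, hrun, ht, hu⟩ := hp hb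
    exact ⟨t + 1, u, .iteTrue hb hrun, Nat.succ_le_succ ht, hu⟩
  · obtain ⟨t, u, hrun, ht, hu⟩ := hq hb
    exact ⟨t + 1, u, .iteFalse hb hrun, Nat.succ_le_succ ht, hu⟩

lemma Ends.block (h : blockPre E K cs Q s) : Ends E K (block cs) s cs.length Q := by
  induction cs generalizing s with
  | nil => exact ⟨0, s, .skip s, le_rfl, h⟩
  | cons c cs ih =>
    obtain ⟨t, u, hrun, ht, hu⟩ := ih h.2
    exact ⟨1 + t, u, .seq (.instr c s h.1) hrun, by rw [List.length_cons]; omega, hu⟩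

lemma Ends.loop (hI : I 0 s) (hreg : ∀ k u, I k u → u.int i = k ∧ u.int j = N)
    (hstep : ∀ k < N, ∀ u, I k u → Ends E K p u T (I (k + 1))) :
    Ends E K (.loop (.intLt i j) p) s (N * (T + 1) + 1) (I N) := by
  suffices key : ∀ r k, k + r = N → ∀ u, I k u →
      Ends E K (.loop (.intLt i j) p) u (r * (T + 1) + 1) (I N) from
    key N 0 (zero_add N) s hI
  intro r
  induction r with
  | zero =>
    intro k hk u hu
    obtain rfl : k = N := hk
    obtain ⟨hi, hj⟩ := hreg k u hu
    exact ⟨1, u, .loopFalse (by simp [hi, hj]), by omega, hu⟩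
  | succ r ih =>
    intro k hk u hu
    obtain ⟨hi, hj⟩ := hreg k u hu
    have hlt : k < N := by omega
    obtain ⟨t, v, hrun, ht, hv⟩ := hstep k hlt u hu
    obtain ⟨t', w, hrun', ht', hw⟩ := ih (k + 1) (by omega) v hv
    refine ⟨t + t' + 1, w, .loopTrue (by simpa [hi, hj] using hlt) hrun hrun', ?_, hw⟩
    rw [add_mul]
    omega

lemma Ends.forLoop (hI : blockPre E K cs (I 0) s)
    (hreg : ∀ k u, I k u → u.int i = k ∧ u.int j = N)
    (hstep : ∀ k < N, ∀ u, I k u → Ends E K p u T (I (k + 1))) :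
    Ends E K (forLoop cs i j p) s (cs.length + (N * (T + 1) + 1)) (I N) :=
  (Ends.block hI).seq fun _ hu => Ends.loop hu hreg hstep

end Rules

/-- Everything but the integer registers in `I` and the real registers in `R` is the same in `s` and
in `u`. -/
structure Frame (I R : Finset ℕ) (s u : State) : Prop where
  int_eq : ∀ r ∉ I, u.int r = s.int r
  real_eq : ∀ r ∉ R, u.real r = s.real r
  mem_eq : u.mem = s.mem
  gaussPos_eq : u.gaussPos = s.gaussPos
  noisePos_eq : u.noisePos = s.noisePos

/-- The registers that CONSTRUCTION, after its header, and QUERY keep constant. -/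
structure Consts (m d : ℕ) (s : State) : Prop where
  numFilters_eq : s.int 0 = m
  dim_eq : s.int 1 = d
  zero_eq : s.int 3 = 0
  one_eq : s.int 4 = 1

section Frame

variable {I I' J R R' : Finset ℕ} {m d : ℕ} {s u v : State}

lemma Frame.trans (h : Frame I R s u) (h' : Frame I R u v) : Frame I R s v where
  int_eq r hr := (h'.int_eq r hr).trans (h.int_eq r hr)
  real_eq r hr := (h'.real_eq r hr).trans (h.real_eq r hr)
  mem_eq := h'.mem_eq.trans h.mem_eq
  gaussPos_eq := h'.gaussPos_eq.trans h.gaussPos_eq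
  noisePos_eq := h'.noisePos_eq.trans h.noisePos_eq

lemma Frame.mono (h : Frame I R s u) (hI : I ⊆ I') (hR : R ⊆ R') : Frame I' R' s u :=
  { h with
    int_eq := fun r hr => h.int_eq r fun hr' => hr (hI hr')
    real_eq := fun r hr => h.real_eq r fun hr' => hr (hR hr') }

lemma Consts.congr (h : Consts m d s) (hint : ∀ r ∈ [0, 1, 3, 4], u.int r = s.int r) :
    Consts m d u where
  numFilters_eq := (hint 0 (by decide)).trans h.numFilters_eq
  dim_eq := (hint 1 (by decide)).trans h.dim_eq
  zero_eq := (hint 3 (by decide)).trans h.zero_eq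
  one_eq := (hint 4 (by decide)).trans h.one_eq

lemma Consts.frame (h : Consts m d s) (hf : Frame I R s u) (hI : ∀ r ∈ [0, 1, 3, 4], r ∉ I) :
    Consts m d u :=
  h.congr fun r hr => hf.int_eq r (hI r hr)

end Frame

/-! ### Inner products -/

/-- Adds to real register `9` the inner product of the `d` memory words from the address in
integer register `10` on with the `d` input words from the index in integer register `11` on, and
moves integer register `10` behind these words. -/
def dotProg : Prog :=
  forLoop [.ofInt 9 3, .intConst 6 0] 6 1 (block [.load 6 10, .intAdd 8 11 6, .input 7 8,
    .mul 6 6 7, .add 9 9 6, .intAdd 10 10 4, .intAdd 6 6 4])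

lemma dotProg_ends {E : Env} {K m d : ℕ} {s : State} (hs : Consts m d s)
    (hK : s.int 10 + d ≤ K) :
    Ends E K dotProg s (8 * d + 3) fun u => Frame {6, 8, 10} {6, 7, 9} s u ∧
      u.int 10 = s.int 10 + d ∧
      u.real 9 = ∑ j ∈ Finset.range d, s.mem (s.int 10 + j) * E.input (s.int 11 + j) := by
  refine (Ends.forLoop (N := d) (T := 7) (I := fun k u => Frame {6, 8, 10} {6, 7, 9} s u ∧
    u.int 6 = k ∧ u.int 10 = s.int 10 + k ∧
    u.real 9 = ∑ j ∈ Finset.range k, s.mem (s.int 10 + j) * E.input (s.int 11 + j))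
    ?_ ?_ ?_).mono (by simp only [List.length_cons, List.length_nil]; omega)
    fun u ⟨hf, _, haddr, hsum⟩ => ⟨hf, haddr, hsum⟩
  · exact ⟨trivial, trivial, ⟨by simp +contextual, by simp +contextual, rfl, rfl, rfl⟩, by simp,
      by simp, by simp [hs.zero_eq]⟩
  · rintro k u ⟨hf, hidx, -, -⟩
    exact ⟨hidx, (hf.int_eq 1 (by decide)).trans hs.dim_eq⟩
  · rintro k hk u ⟨hf, hidx, haddr, hsum⟩
    have hone : u.int 4 = 1 := (hf.int_eq 4 (by decide)).trans hs.one_eq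
    have hsrc : u.int 11 = s.int 11 := hf.int_eq 11 (by decide)
    have hlt : u.int 10 < K := by omega
    exact Ends.block ⟨hlt, trivial, trivial, trivial, trivial, trivial, trivial,
      hf.trans ⟨by simp +contextual, by simp +contextual, rfl, rfl, rfl⟩,
      by simp [hidx, hone], by simp [haddr, hone, add_assoc],
      by simp [Finset.sum_range_succ, hsum, hidx, haddr, hsrc, hf.mem_eq]⟩

lemma addr_add_le {m d i K : ℕ} (hi : i < m) (hK : 1 + m + m * d ≤ K) :
    1 + m + i * d + d ≤ K := by
  have := Nat.mul_le_mul_right d (Nat.succ_le_of_lt hi)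
  rw [Nat.succ_mul] at this
  omega

/-! ### The query program -/

/-- The inner product of the input with the `i`-th filter in memory. -/
def storedDot (E : Env) (m d : ℕ) (mem : ℕ → ℝ) (i : ℕ) : ℝ :=
  ∑ j ∈ Finset.range d, mem (1 + m + (i * d + j)) * E.input j

open Classical in
/-- The contribution of the first `k` filters in memory to the answer of QUERY. -/
def storedAnswer (E : Env) (m d : ℕ) (mem : ℕ → ℝ) (k : ℕ) : ℝ :=
  ∑ i ∈ Finset.range k, if mem 0 ≤ storedDot E m d mem i then mem (1 + i) else 0

/-- The loop body of QUERY; integer register `5` counts the rounds. -/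
def queryBody : Prog :=
  .seq dotProg (.ite (.realLe 5 9)
    (block [.intAdd 8 4 5, .load 6 8, .add 0 0 6, .intAdd 5 5 4]) (block [.intAdd 5 5 4]))

/-- The program for QUERY. -/
def queryProg : Prog :=
  forLoop [.intConst 3 0, .intConst 4 1, .intConst 5 0, .intConst 11 0, .load 5 3, .ofInt 0 3,
    .intAdd 10 4 0] 5 0 queryBody

/-- The loop invariant of QUERY after `k` rounds. -/
structure QueryInv (E : Env) (m d : ℕ) (mem : ℕ → ℝ) (k : ℕ) (u : State) : Prop
    extends Consts m d u where
  mem_eq : u.mem = mem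
  input_eq : u.int 11 = 0
  eta_eq : u.real 5 = mem 0
  index_eq : u.int 5 = k
  addr_eq : u.int 10 = 1 + m + k * d
  answer_eq : u.real 0 = storedAnswer E m d mem k

section Query

variable {E : Env} {K m d k : ℕ} {mem : ℕ → ℝ} {s : State}

lemma queryBody_ends (hk : k < m) (hK : 1 + m + m * d ≤ K) (hs : QueryInv E m d mem k s) :
    Ends E K queryBody s (8 * d + 8) (QueryInv E m d mem (k + 1)) := by
  have haddr : s.int 10 + d ≤ K := hs.addr_eq ▸ addr_add_le hk hK
  refine (dotProg_ends hs.toConsts haddr).seq (T' := 4 + 1) fun u ⟨hf, huaddr, hdot⟩ => ?_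
  have huconsts := hs.toConsts.frame hf (by decide)
  have humem : u.mem = mem := hf.mem_eq.trans hs.mem_eq
  have huinput : u.int 11 = 0 := (hf.int_eq 11 (by decide)).trans hs.input_eq
  have hueta : u.real 5 = mem 0 := (hf.real_eq 5 (by decide)).trans hs.eta_eq
  have huindex : u.int 5 = k := (hf.int_eq 5 (by decide)).trans hs.index_eq
  have huanswer : u.real 0 = storedAnswer E m d mem k :=
    (hf.real_eq 0 (by decide)).trans hs.answer_eq
  have huaddr' : u.int 10 = 1 + m + (k + 1) * d := by
    rw [huaddr, hs.addr_eq]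
    ring
  have hudot : u.real 9 = storedDot E m d mem k := by
    rw [hdot, storedDot, hs.addr_eq, hs.input_eq, hs.mem_eq]
    simp only [zero_add, add_assoc]
  refine Ends.ite (fun hle => ?_) fun hle => ?_ <;>
    simp only [Test.Holds, hueta, hudot] at hle
  · have hlt : u.int 4 + u.int 5 < K := by
      rw [huconsts.one_eq, huindex]
      omega
    exact Ends.block ⟨trivial, hlt, trivial, trivial,
      { huconsts.congr (by simp) with
        mem_eq := humem
        input_eq := huinput
        eta_eq := by simpa using hueta
        index_eq := by simp [huindex, huconsts.one_eq]
        addr_eq := huaddr'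
        answer_eq := by
          simp [storedAnswer, Finset.sum_range_succ, hle, huanswer, humem, huindex,
            huconsts.one_eq] }⟩
  · refine (Ends.block ?_).mono (by simp : [Instr.intAdd 5 5 4].length ≤ 4) fun _ => id
    exact ⟨trivial,
      { huconsts.congr (by simp) with
        mem_eq := humem
        input_eq := huinput
        eta_eq := hueta
        index_eq := by simp [huindex, huconsts.one_eq]
        addr_eq := huaddr'
        answer_eq := by simp [storedAnswer, Finset.sum_range_succ, hle, huanswer] }⟩

lemma queryProg_ends (hm : s.int 0 = m) (hd : s.int 1 = d) (hK : 1 + m + m * d ≤ K) :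
    Ends E K queryProg s (8 + m * (8 * d + 9)) (QueryInv E m d s.mem m) := by
  have hlt : 0 < K := by omega
  refine (Ends.forLoop (I := QueryInv E m d s.mem) ?_
    (fun _ _ hu => ⟨hu.index_eq, hu.numFilters_eq⟩)
    fun k hk u hu => queryBody_ends hk hK hu).mono ?_ fun _ => id
  rotate_left
  · simp only [List.length_cons, List.length_nil]
    exact le_of_eq (by ring)
  exact ⟨trivial, trivial, trivial, trivial, hlt, trivial, trivial,
    ⟨by simpa using hm, by simpa using hd, by simp, by simp⟩, rfl, by simp, by simp, by simp,
    by simp [hm], by simp [storedAnswer]⟩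

end Query

/-! ### The construction program -/

/-- Puts the number of filters into integer register `0`, having moved `n` to integer register `2`,
and sets up the registers for the constants `0` and `1`. -/
def numFiltersProg : Prog :=
  block [.intConst 3 0, .intConst 4 1, .intAdd 2 0 3, .ofInt 12 4, .ofInt 13 3, .mul 5 1 1,
    .sub 5 12 5, .mul 6 0 1, .sub 6 12 6, .mul 6 6 6, .div 5 5 6, .ofInt 6 2, .log 6 6,
    .mul 6 6 5, .exp 6 6, .ceil 0 6]

/-- Puts the query threshold into memory word `0`. -/
def thresholdProg : Prog :=
  block [.ofInt 6 0, .log 6 6, .add 7 6 6, .sqrt 7 7, .mul 7 0 7, .log 6 6, .mul 8 0 0,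
    .sub 8 12 8, .add 8 8 8, .mul 8 8 6, .sqrt 8 8, .sub 5 7 8, .store 3 5]

/-- Puts the truncation radius into real register `4`. -/
def radiusProg : Prog :=
  block [.add 7 3 3, .exp 6 2, .sub 6 6 12, .div 6 6 7, .add 6 12 6, .log 6 6, .div 7 12 2,
    .mul 4 7 6]

/-- Sets all counters to `0`. -/
def clearProg : Prog :=
  forLoop [.intConst 5 0] 5 0 (block [.intAdd 8 4 5, .store 8 13, .intAdd 5 5 4])

/-- Draws the filters. -/
def drawProg : Prog :=
  forLoop [.intConst 5 0, .intMul 9 0 1, .intAdd 10 4 0] 5 9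
    (block [.gauss 6, .intAdd 8 10 5, .store 8 6, .intAdd 5 5 4])

/-- Makes the current filter the best one so far; its inner product is kept in real register `8`
and its index in integer register `9`. -/
def updateMax : Prog := block [.add 8 9 13, .intAdd 9 5 3, .intAdd 5 5 4]

/-- The loop body of `argmaxProg`; integer register `5` counts the rounds. -/
def argmaxBody : Prog :=
  .seq dotProg (.ite (.intLt 3 5) (.ite (.realLe 9 8) (block [.intAdd 5 5 4]) updateMax) updateMax)

/-- Puts into integer register `9` the first filter with the largest inner product with the point
whose coordinates start at the input index in integer register `11`. -/
def argmaxProg : Prog := forLoop [.intConst 5 0, .intAdd 10 4 0] 5 0 argmaxBody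

/-- Counts the points assigned to each filter. -/
def countProg : Prog :=
  forLoop [.intConst 7 0, .intConst 11 0] 7 2 (.seq argmaxProg (block [.intAdd 8 4 9, .load 6 8,
    .add 6 6 12, .store 8 6, .intAdd 11 11 1, .intAdd 7 7 4]))

/-- The loop body of `noiseProg`; integer register `5` counts the rounds. -/
def noiseBody : Prog :=
  .seq (block [.intAdd 8 4 5, .load 6 8, .noise 7, .add 6 6 7]) (.ite (.realLe 6 4)
    (block [.store 8 13, .intAdd 5 5 4]) (block [.store 8 6, .intAdd 5 5 4]))

/-- Adds noise to the counters and replaces small ones by `0`. -/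
def noiseProg : Prog := forLoop [.intConst 5 0] 5 0 noiseBody

/-- The program for CONSTRUCTION. -/
def constructionProg : Prog :=
  .seq numFiltersProg (.seq thresholdProg (.seq radiusProg
    (.seq clearProg (.seq drawProg (.seq countProg noiseProg)))))

/-- The registers that CONSTRUCTION keeps constant once the number of filters and the truncation
radius `A` are computed. -/
structure BuildConsts (m d n : ℕ) (A : ℝ) (s : State) : Prop extends Consts m d s where
  size_eq : s.int 2 = n
  radius_eq : s.real 4 = A
  realOne_eq : s.real 12 = 1
  realZero_eq : s.real 13 = 0

/-- The memory holds the threshold `η`, the first `k` of the counters `c` and, behind the space for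
`m` counters, the first `t` draws of the Gaussian source. -/
structure Table (E : Env) (m : ℕ) (η : ℝ) (c : ℕ → ℝ) (k t : ℕ) (mem : ℕ → ℝ) : Prop where
  eta_eq : mem 0 = η
  counter_eq : ∀ i < k, mem (1 + i) = c i
  filter_eq : ∀ j < t, mem (1 + m + j) = E.gauss j

section State

variable {E : Env} {m d n k t i : ℕ} {A η v : ℝ} {c c' mem : ℕ → ℝ} {s u : State} {I R : Finset ℕ}

lemma BuildConsts.congr (h : BuildConsts m d n A s)
    (hint : ∀ r ∈ [0, 1, 2, 3, 4], u.int r = s.int r)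
    (hreal : ∀ r ∈ [4, 12, 13], u.real r = s.real r) : BuildConsts m d n A u :=
  { h.toConsts.congr fun r hr => hint r ((by decide : [0, 1, 3, 4] ⊆ [0, 1, 2, 3, 4]) hr) with
    size_eq := (hint 2 (by decide)).trans h.size_eq
    radius_eq := (hreal 4 (by decide)).trans h.radius_eq
    realOne_eq := (hreal 12 (by decide)).trans h.realOne_eq
    realZero_eq := (hreal 13 (by decide)).trans h.realZero_eq }

lemma BuildConsts.frame (h : BuildConsts m d n A s) (hf : Frame I R s u)
    (hI : ∀ r ∈ [0, 1, 2, 3, 4], r ∉ I) (hR : ∀ r ∈ [4, 12, 13], r ∉ R) :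
    BuildConsts m d n A u :=
  h.congr (fun r hr => hf.int_eq r (hI r hr)) fun r hr => hf.real_eq r (hR r hr)

lemma Table.congr (h : Table E m η c k t mem) (hc : ∀ i < k, c i = c' i) :
    Table E m η c' k t mem :=
  { h with counter_eq := fun i hi => (h.counter_eq i hi).trans (hc i hi) }

lemma Table.update (h : Table E m η c k t mem) (hi : i < m) :
    Table E m η (Function.update c i v) k t (Function.update mem (1 + i) v) where
  eta_eq := by rw [Function.update_of_ne (by omega), h.eta_eq]
  counter_eq j hj := by
    rcases eq_or_ne j i with rfl | hne
    · simp only [Function.update_self]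
    · rw [Function.update_of_ne (by omega), Function.update_of_ne hne, h.counter_eq j hj]
  filter_eq j hj := by rw [Function.update_of_ne (by omega), h.filter_eq j hj]

lemma Table.snoc_counter (h : Table E m η c k t mem) (hk : k < m) :
    Table E m η c (k + 1) t (Function.update mem (1 + k) (c k)) where
  eta_eq := by rw [Function.update_of_ne (by omega), h.eta_eq]
  counter_eq j hj := by
    rcases eq_or_ne j k with rfl | hne
    · rw [Function.update_self]
    · rw [Function.update_of_ne (by omega), h.counter_eq j (by omega)]
  filter_eq j hj := by rw [Function.update_of_ne (by omega), h.filter_eq j hj]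

lemma Table.snoc_filter (h : Table E m η c k t mem) (hk : k ≤ m) :
    Table E m η c k (t + 1) (Function.update mem (1 + m + t) (E.gauss t)) where
  eta_eq := by rw [Function.update_of_ne (by omega), h.eta_eq]
  counter_eq j hj := by rw [Function.update_of_ne (by omega), h.counter_eq j hj]
  filter_eq j hj := by
    rcases eq_or_ne j t with rfl | hne
    · rw [Function.update_self]
    · rw [Function.update_of_ne (by omega), h.filter_eq j (by omega)]

end State

section Parameters

variable {E : Env} {K : ℕ} {s : State}

lemma numFiltersProg_ends (hn : 1 ≤ s.int 0) :
    Ends E K numFiltersProg s 16 fun u =>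
      Consts (numFilters (s.int 0) (s.real 0) (s.real 1)) (s.int 1) u ∧ u.int 2 = s.int 0 ∧
      u.real 12 = 1 ∧ u.real 13 = 0 ∧ (∀ r ∈ [0, 2, 3], u.real r = s.real r) ∧
      u.gaussPos = s.gaussPos ∧ u.noisePos = s.noisePos := by
  have hm : ⌈Real.exp (Real.log (s.int 0) * ((1 - s.real 1 * s.real 1) /
      ((1 - s.real 0 * s.real 1) * (1 - s.real 0 * s.real 1))))⌉₊ =
      numFilters (s.int 0) (s.real 0) (s.real 1) := by
    rw [numFilters, Real.rpow_def_of_pos (Nat.cast_pos.2 hn), sq, sq]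
  exact Ends.block ⟨trivial, trivial, trivial, trivial, trivial, trivial, trivial, trivial, trivial,
    trivial, trivial, trivial, trivial, trivial, trivial, trivial,
    ⟨by simp [hm], by simp, by simp, by simp⟩, by simp, by simp, by simp, by simp, by simp, by simp⟩

lemma thresholdProg_ends (hK : 0 < K) (hzero : s.int 3 = 0) (hone : s.real 12 = 1) :
    Ends E K thresholdProg s 13 fun u =>
      u.mem 0 = threshold (s.int 0) (s.real 0) ∧ u.int = s.int ∧
      (∀ r ∈ [2, 3, 12, 13], u.real r = s.real r) ∧
      u.gaussPos = s.gaussPos ∧ u.noisePos = s.noisePos :=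
  Ends.block ⟨trivial, trivial, trivial, trivial, trivial, trivial, trivial, trivial, trivial,
    trivial, trivial, trivial, by simpa [hzero] using hK,
    by simp [hzero, hone, threshold, sq, two_mul, add_mul], by simp, by simp, by simp, by simp⟩

lemma radiusProg_ends (hone : s.real 12 = 1) :
    Ends E K radiusProg s 8 fun u =>
      u.real 4 = tlapRadius 1 (s.real 2) (s.real 3) ∧ Frame ∅ {4, 6, 7} s u :=
  Ends.block ⟨trivial, trivial, trivial, trivial, trivial, trivial, trivial, trivial,
    by simp [hone, tlapRadius, two_mul],
    ⟨by simp, by simp +contextual, by simp, by simp, by simp⟩⟩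

end Parameters

section Phases

variable {E : Env} {K m d n : ℕ} {A η : ℝ} {s : State}

lemma clearProg_ends (hK : m < K) (hs : BuildConsts m d n A s) (hη : s.mem 0 = η) :
    Ends E K clearProg s (2 + m * 4) fun u => BuildConsts m d n A u ∧
      Table E m η (fun _ => 0) m 0 u.mem ∧ u.gaussPos = s.gaussPos ∧
      u.noisePos = s.noisePos := by
  refine (Ends.forLoop (N := m) (T := 3) (I := fun k u => BuildConsts m d n A u ∧ u.int 5 = k ∧
    Table E m η (fun _ => 0) k 0 u.mem ∧ u.gaussPos = s.gaussPos ∧ u.noisePos = s.noisePos)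
    ?_ (fun k u hu => ⟨hu.2.1, hu.1.numFilters_eq⟩) ?_).mono ?_ fun u ⟨hu, _, hmem⟩ => ⟨hu, hmem⟩
  · exact ⟨trivial, hs.congr (by simp) (by simp), by simp, ⟨hη, by simp, by simp⟩, rfl, rfl⟩
  · rintro k hk u ⟨hu, hidx, hmem, hgauss, hnoise⟩
    have haddr : u.int 4 + u.int 5 = 1 + k := by rw [hu.one_eq, hidx]
    have hlt : u.int 4 + u.int 5 < K := by omega
    exact Ends.block ⟨trivial, hlt, trivial, hu.congr (by simp) (by simp),
      by simp [hidx, hu.one_eq], by simpa [haddr, hu.realZero_eq] using hmem.snoc_counter hk,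
      hgauss, hnoise⟩
  · simp only [List.length_cons, List.length_nil]
    exact le_of_eq (by ring)

lemma drawProg_ends {c : ℕ → ℝ} (hK : 1 + m + m * d ≤ K) (hs : BuildConsts m d n A s)
    (ht : Table E m η c m 0 s.mem) (hg : s.gaussPos = 0) :
    Ends E K drawProg s (4 + m * d * 5) fun u => BuildConsts m d n A u ∧
      Table E m η c m (m * d) u.mem ∧ u.noisePos = s.noisePos := by
  refine (Ends.forLoop (N := m * d) (T := 4) (I := fun k u => BuildConsts m d n A u ∧
    u.int 5 = k ∧ u.int 9 = m * d ∧ u.int 10 = 1 + m ∧ Table E m η c m k u.mem ∧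
    u.gaussPos = k ∧ u.noisePos = s.noisePos)
    ?_ (fun k u hu => ⟨hu.2.1, hu.2.2.1⟩) ?_).mono ?_
    fun u ⟨hu, _, _, _, hmem, _, hnoise⟩ => ⟨hu, hmem, hnoise⟩
  · exact ⟨trivial, trivial, trivial, hs.congr (by simp) (by simp), by simp,
      by simp [hs.numFilters_eq, hs.dim_eq], by simp [hs.numFilters_eq, hs.one_eq], ht, hg, rfl⟩
  · rintro k hk u ⟨hu, hidx, hlen, hbase, hmem, hgauss, hnoise⟩
    have haddr : u.int 10 + u.int 5 = 1 + m + k := by rw [hbase, hidx]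
    have hlt : u.int 10 + u.int 5 < K := by omega
    exact Ends.block ⟨trivial, trivial, hlt, trivial, hu.congr (by simp) (by simp),
      by simp [hidx, hu.one_eq], hlen, hbase,
      by simpa [haddr, hgauss] using hmem.snoc_filter le_rfl, by simp [hgauss], hnoise⟩
  · simp only [List.length_cons, List.length_nil]
    exact le_of_eq (by ring)

/-- The inner product of filter `i` with point `k` of the input, when the filters are the draws of
the Gaussian source. -/
def filterDot (E : Env) (d i k : ℕ) : ℝ :=
  ∑ j ∈ Finset.range d, E.gauss (i * d + j) * E.input (k * d + j)

/-- `b` is the first index below `m` with the largest inner product with point `k`: the counterpart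
of `IsArgmax` for data given by the input array and the Gaussian source. -/
structure IsFirstMax (E : Env) (m d k b : ℕ) : Prop where
  lt : b < m
  le : ∀ j < m, filterDot E d j k ≤ filterDot E d b k
  lt_of_lt : ∀ j < b, filterDot E d j k < filterDot E d b k

lemma IsFirstMax.one (k : ℕ) : IsFirstMax E 1 d k 0 where
  lt := one_pos
  le j hj := by rw [Nat.lt_one_iff.1 hj]
  lt_of_lt j hj := absurd hj j.not_lt_zero

lemma IsFirstMax.succ_of_le {k b : ℕ} (h : IsFirstMax E m d k b)
    (hle : filterDot E d m k ≤ filterDot E d b k) : IsFirstMax E (m + 1) d k b where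
  lt := h.lt.trans m.lt_succ_self
  le j hj := (Nat.lt_succ_iff_lt_or_eq.1 hj).elim (h.le j) fun hjm => hjm ▸ hle
  lt_of_lt := h.lt_of_lt

lemma IsFirstMax.succ_of_lt {k b : ℕ} (h : IsFirstMax E m d k b)
    (hlt : filterDot E d b k < filterDot E d m k) : IsFirstMax E (m + 1) d k m where
  lt := m.lt_succ_self
  le j hj := (Nat.lt_succ_iff_lt_or_eq.1 hj).elim (fun hjm => ((h.le j hjm).trans_lt hlt).le)
    fun hjm => hjm ▸ le_rfl
  lt_of_lt j hj := (h.le j hj).trans_lt hlt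

lemma IsFirstMax.unique {k b b' : ℕ} (h : IsFirstMax E m d k b) (h' : IsFirstMax E m d k b') :
    b = b' := by
  rcases lt_trichotomy b b' with hlt | heq | hlt
  · exact absurd (h'.lt_of_lt b hlt) (h.le b' h'.lt).not_gt
  · exact heq
  · exact absurd (h.lt_of_lt b' hlt) (h'.le b h.lt).not_gt

/-- The loop invariant of `argmaxProg`, started in `s`, after `i` rounds. -/
structure ArgmaxInv (E : Env) (m d k : ℕ) (s : State) (i : ℕ) (u : State) : Prop where
  frame : Frame {5, 6, 8, 9, 10} {6, 7, 8, 9} s u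
  index_eq : u.int 5 = i
  addr_eq : u.int 10 = 1 + m + i * d
  isFirstMax : 0 < i → IsFirstMax E i d k (u.int 9)
  max_eq : 0 < i → u.real 8 = filterDot E d (u.int 9) k

lemma updateMax_ends {k i : ℕ} {u : State} (hs : BuildConsts m d n A s)
    (hf : Frame {5, 6, 8, 9, 10} {6, 7, 8, 9} s u) (hidx : u.int 5 = i)
    (haddr : u.int 10 = 1 + m + (i + 1) * d) (hdot : u.real 9 = filterDot E d i k)
    (hmax : IsFirstMax E (i + 1) d k i) :
    Ends E K updateMax u 3 (ArgmaxInv E m d k s (i + 1)) := by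
  have hu := hs.frame hf (by decide) (by decide)
  exact Ends.block ⟨trivial, trivial, trivial,
    { frame := hf.trans ⟨by simp +contextual, by simp +contextual, rfl, rfl, rfl⟩
      index_eq := by simp [hidx, hu.one_eq]
      addr_eq := by simpa using haddr
      isFirstMax := fun _ => by simpa [hidx, hu.zero_eq] using hmax
      max_eq := fun _ => by simp [hidx, hu.zero_eq, hu.realZero_eq, hdot] }⟩

lemma argmaxBody_ends {c : ℕ → ℝ} {k i : ℕ} {u : State} (hi : i < m) (hK : 1 + m + m * d ≤ K)
    (hs : BuildConsts m d n A s) (ht : Table E m η c m (m * d) s.mem) (hsrc : s.int 11 = k * d)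
    (hu : ArgmaxInv E m d k s i u) :
    Ends E K argmaxBody u (8 * d + 8) (ArgmaxInv E m d k s (i + 1)) := by
  have huconsts := hs.frame hu.frame (by decide) (by decide)
  have haddr : u.int 10 + d ≤ K := hu.addr_eq ▸ addr_add_le hi hK
  refine (dotProg_ends huconsts.toConsts haddr).seq (T' := 3 + 1 + 1)
    fun v ⟨hv, hvaddr, hdot⟩ => ?_
  have hf : Frame {5, 6, 8, 9, 10} {6, 7, 8, 9} s v :=
    hu.frame.trans (hv.mono (by decide) (by decide))
  have hvconsts := hs.frame hf (by decide) (by decide)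
  have hvidx : v.int 5 = i := (hv.int_eq 5 (by decide)).trans hu.index_eq
  have hvaddr' : v.int 10 = 1 + m + (i + 1) * d := by
    rw [hvaddr, hu.addr_eq]
    ring
  have hdot' : v.real 9 = filterDot E d i k := by
    rw [hdot, filterDot]
    refine Finset.sum_congr rfl fun j hj => ?_
    have hlt := addr_add_le hi le_rfl (d := d)
    rw [hu.addr_eq, hu.frame.int_eq 11 (by decide), hsrc, hu.frame.mem_eq, add_assoc (1 + m),
      ht.filter_eq _ (by have := Finset.mem_range.1 hj; omega)]
  have hbest : v.int 9 = u.int 9 := hv.int_eq 9 (by decide)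
  have hval : v.real 8 = u.real 8 := hv.real_eq 8 (by decide)
  refine Ends.ite (fun hpos => Ends.ite (fun hle => ?_) fun hle => ?_) fun hpos =>
    (updateMax_ends hs hf hvidx hvaddr' hdot' ?_).mono (Nat.le_succ 3) fun _ => id
  all_goals simp only [Test.Holds, hvconsts.zero_eq, hvidx] at hpos
  · have hmax := hu.isFirstMax hpos
    rw [Test.Holds, hdot', hval, hu.max_eq hpos] at hle
    refine (Ends.block ?_).mono (by simp : [Instr.intAdd 5 5 4].length ≤ 3) fun _ => id
    exact ⟨trivial,
      { frame := hf.trans ⟨by simp +contextual, by simp +contextual, rfl, rfl, rfl⟩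
        index_eq := by simp [hvidx, hvconsts.one_eq]
        addr_eq := by simpa using hvaddr'
        isFirstMax := fun _ => by simpa [hbest] using hmax.succ_of_le hle
        max_eq := fun _ => by simp [hbest, hval, hu.max_eq hpos] }⟩
  · rw [Test.Holds, hdot', hval, hu.max_eq hpos] at hle
    exact updateMax_ends hs hf hvidx hvaddr' hdot' ((hu.isFirstMax hpos).succ_of_lt (not_le.1 hle))
  · obtain rfl : i = 0 := by omega
    exact IsFirstMax.one k

lemma argmaxProg_ends {c : ℕ → ℝ} {k : ℕ} (hm : 0 < m) (hK : 1 + m + m * d ≤ K)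
    (hs : BuildConsts m d n A s) (ht : Table E m η c m (m * d) s.mem) (hsrc : s.int 11 = k * d) :
    Ends E K argmaxProg s (3 + m * (8 * d + 9)) fun u =>
      Frame {5, 6, 8, 9, 10} {6, 7, 8, 9} s u ∧ IsFirstMax E m d k (u.int 9) := by
  refine (Ends.forLoop (I := ArgmaxInv E m d k s) ?_ (fun _ u hu => ⟨hu.index_eq,
    (hs.frame hu.frame (by decide) (by decide)).numFilters_eq⟩)
    fun i hi u hu => argmaxBody_ends hi hK hs ht hsrc hu).mono ?_
    fun u hu => ⟨hu.frame, hu.isFirstMax hm⟩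
  · exact ⟨trivial, trivial,
      { frame := ⟨by simp +contextual, by simp, rfl, rfl, rfl⟩
        index_eq := by simp
        addr_eq := by simp [hs.one_eq, hs.numFilters_eq]
        isFirstMax := fun h => absurd h (lt_irrefl 0)
        max_eq := fun h => absurd h (lt_irrefl 0) }⟩
  · simp only [List.length_cons, List.length_nil]
    exact le_of_eq (by ring)

open Classical in
/-- The number of the first `k` points that are assigned to filter `i`. -/
def firstMaxCount (E : Env) (m d k i : ℕ) : ℕ :=
  ((Finset.range k).filter fun k' => IsFirstMax E m d k' i).card

lemma firstMaxCount_succ {k b : ℕ} (h : IsFirstMax E m d k b) (i : ℕ) :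
    (firstMaxCount E m d (k + 1) i : ℝ) = Function.update
      (fun i => (firstMaxCount E m d k i : ℝ)) b (firstMaxCount E m d k b + 1) i := by
  classical
  rw [firstMaxCount, Finset.range_add_one, Finset.filter_insert]
  rcases eq_or_ne i b with rfl | hne
  · rw [if_pos h, Finset.card_insert_of_notMem (by simp), Function.update_self, Nat.cast_succ]
    rfl
  · rw [if_neg fun h' => hne (h'.unique h), Function.update_of_ne hne]
    rfl

lemma countProg_ends (hm : 0 < m) (hK : 1 + m + m * d ≤ K) (hs : BuildConsts m d n A s)
    (ht : Table E m η (fun _ => 0) m (m * d) s.mem) :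
    Ends E K countProg s (3 + n * (10 + m * (8 * d + 9))) fun u => BuildConsts m d n A u ∧
      Table E m η (fun i => firstMaxCount E m d n i) m (m * d) u.mem ∧
      u.noisePos = s.noisePos := by
  refine (Ends.forLoop (N := n) (T := 3 + m * (8 * d + 9) + 6) (I := fun k u =>
    BuildConsts m d n A u ∧ Table E m η (fun i => firstMaxCount E m d k i) m (m * d) u.mem ∧
    u.int 7 = k ∧ u.int 11 = k * d ∧ u.noisePos = s.noisePos)
    ?_ (fun k u hu => ⟨hu.2.2.1, hu.1.size_eq⟩) ?_).mono ?_
    fun u ⟨hu, hmem, _, _, hnoise⟩ => ⟨hu, hmem, hnoise⟩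
  · exact ⟨trivial, trivial, hs.congr (by simp) (by simp), ht.congr (by simp [firstMaxCount]),
      by simp, by simp, rfl⟩
  · rintro k - u ⟨hu, hmem, hidx, hsrc, hnoise⟩
    refine (argmaxProg_ends hm hK hu hmem hsrc).seq fun v ⟨hf, hmax⟩ => ?_
    have hv := hu.frame hf (by decide) (by decide)
    have hmax_lt := hmax.lt
    have hlt : v.int 4 + v.int 9 < K := by
      rw [hv.one_eq]
      omega
    have hcounter : u.mem (1 + v.int 9) = firstMaxCount E m d k (v.int 9) :=
      hmem.counter_eq _ hmax.lt
    have hmem' := (hmem.update hmax.lt).congr fun i _ => (firstMaxCount_succ hmax i).symm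
    refine Ends.block ⟨trivial, hlt, trivial, hlt, trivial, trivial,
      hv.congr (by simp) (by simp), ?_, ?_, ?_, hf.noisePos_eq.trans hnoise⟩
    · simpa [hv.one_eq, hv.realOne_eq, hf.mem_eq, hcounter] using hmem'
    · simp [hf.int_eq 7 (by decide), hidx, hv.one_eq]
    · simp [hf.int_eq 11 (by decide), hsrc, hv.dim_eq, add_mul]
  · simp only [List.length_cons, List.length_nil]
    exact le_of_eq (by ring)

end Phases

/-- The counter that CONSTRUCTION releases for the count `c` and the noise `z`, when `A` is the
truncation radius. -/
def noisyCounter (A c z : ℝ) : ℝ := if c + z ≤ A then 0 else c + z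

/-- The loop invariant of `noiseProg` after `k` rounds. -/
structure NoiseInv (E : Env) (m d n : ℕ) (A η : ℝ) (c : ℕ → ℝ) (k : ℕ) (u : State) : Prop
    extends BuildConsts m d n A u where
  index_eq : u.int 5 = k
  noisePos_eq : u.noisePos = k
  table : Table E m η (fun i => if i < k then noisyCounter A (c i) (E.noise i) else c i) m (m * d)
    u.mem

section Construction

variable {E : Env} {K m d n k : ℕ} {A η : ℝ} {c : ℕ → ℝ} {s : State}

lemma Table.snoc_noise (hk : k < m)
    (h : Table E m η (fun i => if i < k then noisyCounter A (c i) (E.noise i) else c i) m (m * d)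
      s.mem) :
    Table E m η (fun i => if i < k + 1 then noisyCounter A (c i) (E.noise i) else c i) m (m * d)
      (Function.update s.mem (1 + k) (noisyCounter A (c k) (E.noise k))) := by
  refine (h.update hk).congr fun i _ => ?_
  rcases eq_or_ne i k with rfl | hne
  · rw [Function.update_self, if_pos i.lt_succ_self]
  · rw [Function.update_of_ne hne]
    exact if_congr (by omega) rfl rfl

lemma noiseBody_ends (hk : k < m) (hK : m < K) (hs : NoiseInv E m d n A η c k s) :
    Ends E K noiseBody s 7 (NoiseInv E m d n A η c (k + 1)) := by
  have haddr : s.int 4 + s.int 5 = 1 + k := by rw [hs.one_eq, hs.index_eq]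
  have hlt : s.int 4 + s.int 5 < K := by omega
  have hcounter : s.mem (1 + k) = c k := by
    rw [hs.table.counter_eq k hk, if_neg (lt_irrefl k)]
  have htable := hs.table.snoc_noise hk
  refine Ends.seq (T' := 2 + 1) (R := fun u => BuildConsts m d n A u ∧ u.mem = s.mem ∧
    u.int 5 = k ∧ u.int 8 = 1 + k ∧ u.noisePos = k + 1 ∧ u.real 6 = c k + E.noise k)
    (Ends.block ⟨trivial, hlt, trivial, trivial, hs.congr (by simp) (by simp), rfl,
      by simp [hs.index_eq], by simp [haddr], by simp [hs.noisePos_eq],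
      by simp [haddr, hcounter, hs.noisePos_eq]⟩) fun u ⟨hu, hmem, hidx, haddr', hpos, hval⟩ => ?_
  have hlt' : u.int 8 < K := by omega
  refine Ends.ite (fun hle => ?_) fun hle => ?_ <;> rw [Test.Holds, hval, hu.radius_eq] at hle
  · exact Ends.block ⟨hlt', trivial,
      { hu.congr (by simp) (by simp) with
        index_eq := by simp [hidx, hu.one_eq]
        noisePos_eq := hpos
        table := by simpa [noisyCounter, hle, hmem, haddr', hu.realZero_eq] using htable }⟩
  · exact Ends.block ⟨hlt', trivial,
      { hu.congr (by simp) (by simp) with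
        index_eq := by simp [hidx, hu.one_eq]
        noisePos_eq := hpos
        table := by simpa [noisyCounter, hle, hmem, haddr', hval] using htable }⟩

lemma noiseProg_ends (hK : m < K) (hs : BuildConsts m d n A s)
    (ht : Table E m η c m (m * d) s.mem) (hpos : s.noisePos = 0) :
    Ends E K noiseProg s (2 + m * 8) fun u => BuildConsts m d n A u ∧
      Table E m η (fun i => noisyCounter A (c i) (E.noise i)) m (m * d) u.mem := by
  refine (Ends.forLoop (I := NoiseInv E m d n A η c) ?_
    (fun _ _ hu => ⟨hu.index_eq, hu.numFilters_eq⟩)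
    fun k hk u hu => noiseBody_ends hk hK hu).mono ?_
    fun u hu => ⟨hu.toBuildConsts, hu.table.congr fun i hi => if_pos hi⟩
  · exact ⟨trivial,
      { hs.congr (by simp) (by simp) with
        index_eq := by simp
        noisePos_eq := hpos
        table := by simpa using ht }⟩
  · simp only [List.length_cons, List.length_nil]
    exact le_of_eq (by ring)

lemma constructionProg_ends (hn : 1 ≤ s.int 0) (hm : numFilters (s.int 0) (s.real 0) (s.real 1) = m)
    (hm0 : 0 < m) (hd : s.int 1 = d) (hK : 1 + m + m * d ≤ K) (hg : s.gaussPos = 0)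
    (hz : s.noisePos = 0) :
    Ends E K constructionProg s
      (48 + 12 * m + 5 * (m * d) + s.int 0 * (10 + m * (8 * d + 9))) fun u =>
        Consts m d u ∧ Table E m (threshold m (s.real 0))
          (fun i => noisyCounter (tlapRadius 1 (s.real 2) (s.real 3))
            (firstMaxCount E m d (s.int 0) i) (E.noise i)) m (m * d) u.mem := by
  refine ((numFiltersProg_ends hn).seq (T' := 13 + (8 + ((2 + m * 4) + ((4 + m * d * 5) +
    ((3 + s.int 0 * (10 + m * (8 * d + 9))) + (2 + m * 8))))))
    fun u ⟨hu, hsize, hone, hzero, hreal, hgu, hzu⟩ => ?_).mono (by omega) fun _ => id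
  rw [hm, hd] at hu
  refine (thresholdProg_ends (by omega) hu.zero_eq hone).seq
    fun v ⟨heta, hint, hreal', hgv, hzv⟩ => ?_
  refine (radiusProg_ends ((hreal' 12 (by decide)).trans hone)).seq fun w ⟨hrad, hf⟩ => ?_
  rw [hu.numFilters_eq, hreal 0 (by decide)] at heta
  rw [hreal' 2 (by decide), hreal' 3 (by decide), hreal 2 (by decide), hreal 3 (by decide)] at hrad
  have hw : BuildConsts m d (s.int 0) (tlapRadius 1 (s.real 2) (s.real 3)) w :=
    { (hu.congr fun r _ => congrFun hint r).frame hf (by decide) with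
      size_eq := by rw [hf.int_eq 2 (by decide), hint, hsize]
      radius_eq := hrad
      realOne_eq := by rw [hf.real_eq 12 (by decide), hreal' 12 (by decide), hone]
      realZero_eq := by rw [hf.real_eq 13 (by decide), hreal' 13 (by decide), hzero] }
  have hgw : w.gaussPos = 0 := by rw [hf.gaussPos_eq, hgv, hgu, hg]
  have hzw : w.noisePos = 0 := by rw [hf.noisePos_eq, hzv, hzu, hz]
  have hetaw : w.mem 0 = threshold m (s.real 0) := by rw [hf.mem_eq, heta]
  refine (clearProg_ends (by omega) hw hetaw).seq
    fun a ⟨ha, hta, hga, hza⟩ => ?_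
  refine (drawProg_ends hK ha hta (hga.trans hgw)).seq fun b ⟨hb, htb, hzb⟩ => ?_
  refine (countProg_ends hm0 hK hb htb).seq fun c ⟨hc, htc, hzc⟩ => ?_
  exact (noiseProg_ends (by omega) hc htc (by rw [hzc, hzb, hza, hzw])).mono le_rfl
    fun u ⟨hu, htu⟩ => ⟨hu.toConsts, htu⟩

end Construction

/-! ### Correctness and complexity of the programs -/

section Correctness

variable {E : Env} {K n d m : ℕ} {α β ε δ : ℝ} {s : State} {x : Fin n → Sph d}
  {g : Fin m → Fin d → ℝ}

lemma inner_eq_filterDot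
    (hx : ∀ (i : Fin n) (j : Fin d), E.input (i * d + j) = (x i : Vec d) j)
    (hg : ∀ (i : Fin m) (j : Fin d), E.gauss (i * d + j) = g i j) (i : Fin m) (k : Fin n) :
    ⟪toFilters g i, (x k : Vec d)⟫ = filterDot E d i k := by
  rw [filterDot, Finset.sum_range, PiLp.inner_apply]
  refine Finset.sum_congr rfl fun j _ => ?_
  rw [hg, hx]
  simp [toFilters, mul_comm]

lemma isFirstMax_iff
    (hx : ∀ (i : Fin n) (j : Fin d), E.input (i * d + j) = (x i : Vec d) j)
    (hg : ∀ (i : Fin m) (j : Fin d), E.gauss (i * d + j) = g i j) (i : Fin m) (k : Fin n) :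
    IsFirstMax E m d k i ↔ IsArgmax (toFilters g) (x k : Vec d) i := by
  simp only [IsArgmax, inner_eq_filterDot hx hg]
  exact ⟨fun h => ⟨fun j => h.le j j.2, fun j hj => h.lt_of_lt j hj⟩, fun h =>
    ⟨i.2, fun j hj => h.1 ⟨j, hj⟩, fun j hj => h.2 ⟨j, hj.trans i.2⟩ hj⟩⟩

lemma firstMaxCount_eq_bucketCount
    (hx : ∀ (i : Fin n) (j : Fin d), E.input (i * d + j) = (x i : Vec d) j)
    (hg : ∀ (i : Fin m) (j : Fin d), E.gauss (i * d + j) = g i j) (i : Fin m) :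
    firstMaxCount E m d n i = bucketCount (toFilters g) (Finset.univ.val.map x) i := by
  classical
  rw [bucketCount_map, firstMaxCount, Finset.card_filter, Finset.card_filter, Finset.sum_range]
  exact Finset.sum_congr rfl fun k _ => if_congr (isFirstMax_iff hx hg i k) rfl rfl

lemma inner_eq_storedDot {D : Data d m} {q : Sph d} {mem : ℕ → ℝ}
    (hD : ∀ (i : Fin m) (j : Fin d), mem (1 + m + (i * d + j)) = D.filters i j)
    (hq : ∀ j : Fin d, E.input j = (q : Vec d) j) (i : Fin m) :
    ⟪D.filters i, (q : Vec d)⟫ = storedDot E m d mem i := by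
  rw [storedDot, Finset.sum_range, PiLp.inner_apply]
  refine Finset.sum_congr rfl fun j _ => ?_
  rw [hD, hq]
  simp [mul_comm]

lemma mul_add_lt (i : Fin m) (j : Fin d) : (i : ℕ) * d + j < m * d := by
  have := addr_add_le (d := d) i.2 le_rfl
  omega

lemma constructionProg_correct {g : Fin (numFilters n α β) → Fin d → ℝ}
    {z : Fin (numFilters n α β) → ℝ} (hn : 1 ≤ n) (hm : 0 < numFilters n α β)
    (hK : 1 + numFilters n α β + numFilters n α β * d ≤ K) (hs : Init α β ε δ x g z E s) :
    Ends E K constructionProg s (48 + 12 * numFilters n α β + 5 * (numFilters n α β * d) +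
      n * (10 + numFilters n α β * (8 * d + 9))) fun u =>
      Stores u (build n α β ε δ (Finset.univ.val.map x) g z) := by
  obtain ⟨rfl, rfl, rfl, rfl, rfl, rfl, hgpos, hzpos, hx, hg, hz⟩ := hs
  refine (constructionProg_ends hn rfl hm rfl hK hgpos hzpos).mono le_rfl
    fun u ⟨hu, hmem⟩ => ⟨hu.numFilters_eq, hu.dim_eq, hmem.eta_eq, fun i => ?_, fun i j => ?_⟩
  · rw [hmem.counter_eq i i.2, firstMaxCount_eq_bucketCount hx hg i, hz]
    rfl
  · rw [hmem.filter_eq _ (mul_add_lt i j), hg]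
    rfl

lemma queryProg_correct {D : Data d m} {q : Sph d} (hK : 1 + m + m * d ≤ K) (hs : Stores s D)
    (hq : ∀ j : Fin d, E.input j = (q : Vec d) j) :
    Ends E K queryProg s (8 + m * (8 * d + 9)) fun u => Stores u D ∧ u.real 0 = D.query q := by
  classical
  obtain ⟨hm, hd, heta, hcounter, hfilter⟩ := hs
  refine (queryProg_ends hm hd hK).mono le_rfl fun u hu => ⟨⟨hu.numFilters_eq, hu.dim_eq, ?_⟩, ?_⟩
  · rw [hu.mem_eq]
    exact ⟨heta, hcounter, hfilter⟩
  · rw [hu.answer_eq, storedAnswer, Finset.sum_range, Data.query, Finset.sum_filter]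
    refine Finset.sum_congr rfl fun i _ => ?_
    rw [inner_eq_storedDot hfilter hq, heta, hcounter]

end Correctness

section Complexity

variable {n d m : ℕ} {α β : ℝ}

lemma construction_time_le (hn : 1 ≤ n) (hd : 1 ≤ d) (hm : 0 < m) :
    48 + 12 * m + 5 * (m * d) + n * (10 + m * (8 * d + 9)) ≤ 92 * (n * (m * d)) := by
  have hmd : m ≤ m * d := Nat.le_mul_of_pos_right _ hd
  have hnmd : m * d ≤ n * (m * d) := Nat.le_mul_of_pos_left _ hn
  have hnm : n * m ≤ n * (m * d) := Nat.mul_le_mul_left n hmd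
  have hn' : n * 1 ≤ n * m := Nat.mul_le_mul_left n hm
  have hexpand : n * (10 + m * (8 * d + 9)) = 10 * n + 8 * (n * (m * d)) + 9 * (n * m) := by ring
  omega

lemma query_time_le (hd : 1 ≤ d) (hm : 0 < m) : 8 + m * (8 * d + 9) ≤ 25 * (m * d) := by
  have hmd : m ≤ m * d := Nat.le_mul_of_pos_right _ hd
  have hexpand : m * (8 * d + 9) = 8 * (m * d) + 9 * m := by ring
  omega

lemma numFilters_mul_dim_le (d : ℕ) (hn : 1 ≤ n) (hβ0 : 0 ≤ β) (hβ : β ≤ α) (hα : α < 1) :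
    ((numFilters n α β * d : ℕ) : ℝ) ≤ 2 * (d * (n : ℝ) ^ (rho α β / (1 - α ^ 2))) := by
  rw [rho_div (by nlinarith), Nat.cast_mul]
  calc (numFilters n α β : ℝ) * d
      ≤ 2 * (n : ℝ) ^ ((1 - β ^ 2) / (1 - α * β) ^ 2) * d :=
        mul_le_mul_of_nonneg_right (numFilters_le hn hβ0 hβ hα) d.cast_nonneg
    _ = 2 * (d * (n : ℝ) ^ ((1 - β ^ 2) / (1 - α * β) ^ 2)) := by ring

theorem exists_programs : ∃ (pre qry : Prog) (C : ℝ), ∀ (d n : ℕ), 1 ≤ d → 1 ≤ n →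
    ∀ α β ε δ : ℝ, 0 ≤ β → β ≤ α → α < 1 →
    ∃ K : ℕ, (K : ℝ) ≤ C * (d * (n : ℝ) ^ (rho α β / (1 - α ^ 2))) ∧
      ∀ (x : Fin n → Sph d) (g : Fin (numFilters n α β) → Fin d → ℝ)
        (z : Fin (numFilters n α β) → ℝ) (D : Data d (numFilters n α β)),
        D = build n α β ε δ (Finset.univ.val.map x) g z →
        D.words ≤ K ∧
        (∀ (E : Env) (s : State), Init α β ε δ x g z E s →
          ∃ (t : ℕ) (s' : State), Run E K pre s t s' ∧
            (t : ℝ) ≤ C * (d * (n : ℝ) ^ (1 + rho α β / (1 - α ^ 2))) ∧ Stores s' D) ∧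
        ∀ (q : Sph d) (E : Env) (s : State),
          Stores s D → (∀ j : Fin d, E.input j = (q : Vec d) j) →
          ∃ (t : ℕ) (s' : State), Run E K qry s t s' ∧
            (t : ℝ) ≤ C * (d * (n : ℝ) ^ (rho α β / (1 - α ^ 2))) ∧
            Stores s' D ∧ s'.real 0 = D.query q := by
  refine ⟨constructionProg, queryProg, 200, fun d n hd hn α β ε δ hβ0 hβ hα => ?_⟩
  have hm := numFilters_pos hn hβ0 hβ hα
  have hn0 : (0 : ℝ) < n := Nat.cast_pos.2 hn
  have hmd := numFilters_mul_dim_le d hn hβ0 hβ hα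
  rw [Real.rpow_add hn0, Real.rpow_one]
  set P : ℝ := (n : ℝ) ^ (rho α β / (1 - α ^ 2))
  set m := numFilters n α β
  have hdP : 0 ≤ d * P := by positivity
  have hsmall : ∀ t : ℕ, t ≤ 25 * (m * d) → (t : ℝ) ≤ 200 * (d * P) := by
    intro t ht
    calc (t : ℝ) ≤ 25 * ((m * d : ℕ) : ℝ) := by exact_mod_cast ht
      _ ≤ 25 * (2 * (d * P)) := by gcongr
      _ ≤ 200 * (d * P) := by linarith
  have hlarge : ∀ t : ℕ, t ≤ 92 * (n * (m * d)) → (t : ℝ) ≤ 200 * (d * (n * P)) := by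
    intro t ht
    calc (t : ℝ) ≤ 92 * (n * ((m * d : ℕ) : ℝ)) := by exact_mod_cast ht
      _ ≤ 92 * (n * (2 * (d * P))) := by gcongr
      _ ≤ 200 * (d * (n * P)) := by linarith [mul_nonneg hn0.le hdP]
  have hspace : 1 + m + m * d ≤ 25 * (m * d) := by
    have := Nat.le_mul_of_pos_right m hd
    omega
  refine ⟨1 + m + m * d, hsmall _ hspace, ?_⟩
  rintro x g z D rfl
  refine ⟨le_rfl, fun E s hs => ?_, fun q E s hs hq => ?_⟩
  · obtain ⟨t, s', hrun, ht, hstores⟩ := constructionProg_correct hn hm le_rfl hs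
    exact ⟨t, s', hrun, hlarge t (ht.trans (construction_time_le hn hd hm)), hstores⟩
  · obtain ⟨t, s', hrun, ht, hstores⟩ := queryProg_correct le_rfl hs hq
    exact ⟨t, s', hrun, hsmall t (ht.trans (query_time_le hd hm)), hstores⟩

end Complexity

end RAM

end DPTopOne

end

theorem theorem1_general :
    (∀ (d n : ℕ) (α β ε δ : ℝ), 0 < ε → 0 < δ → δ < 1 / 2 →
      (∀ S : Multiset (Sph d), IsProbabilityMeasure (construction n α β ε δ S)) ∧
      IsDP ε δ (fun S : Multiset (Sph d) => construction n α β ε δ S)) ∧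
    (∀ α β : ℕ → ℝ, (∀ n, 0 ≤ β n) → (∀ n, β n ≤ α n) → (∀ n, α n < 1) →
      (fun n : ℕ => Real.log (Real.log (numFilters n (α n) (β n))) /
          Real.log (numFilters n (α n) (β n)))
        =o[atTop] (fun n => 1 - α n ^ 2) →
      ∃ e₁ e₂ : ℕ → ℝ, Tendsto e₁ atTop (𝓝 0) ∧ Tendsto e₂ atTop (𝓝 0) ∧
        ∀ ε₀ : ℝ, 0 < ε₀ → ∃ C : ℝ, 0 < C ∧ ∀ᶠ n : ℕ in atTop,
          ∀ (d : ℕ) (ε δ : ℝ), 0 < ε → ε ≤ ε₀ → 0 < δ → δ < 1 / 2 →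
          ∀ (S : Multiset (Sph d)) (q : Sph d), S.card = n →
            2 / 3 ≤ construction n (α n) (β n) ε δ S
              {D | (1 - e₁ n) * (ballCount S q (α n) : ℝ)
                      - C * (Real.log (1 / δ) / ε * (n : ℝ) ^ (rho (α n) (β n) + e₂ n))
                    ≤ D.query q ∧
                  D.query q ≤ (ballCount S q (β n) : ℝ)
                      + C * (Real.log (1 / δ) / ε * (n : ℝ) ^ (rho (α n) (β n) + e₂ n))}) ∧
    (∃ (pre qry : RAM.Prog) (C : ℝ), ∀ (d n : ℕ), 1 ≤ d → 1 ≤ n →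
      ∀ α β ε δ : ℝ, 0 ≤ β → β ≤ α → α < 1 → 0 < ε → 0 < δ →
      ∃ K : ℕ, (K : ℝ) ≤ C * (d * (n : ℝ) ^ (rho α β / (1 - α ^ 2))) ∧
        ∀ (x : Fin n → Sph d) (g : Fin (numFilters n α β) → Fin d → ℝ)
          (z : Fin (numFilters n α β) → ℝ) (D : Data d (numFilters n α β)),
          D = build n α β ε δ (Finset.univ.val.map x) g z →
          D.words ≤ K ∧
          (∀ (E : RAM.Env) (s : RAM.State), RAM.Init α β ε δ x g z E s →
            ∃ (t : ℕ) (s' : RAM.State), RAM.Run E K pre s t s' ∧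
              (t : ℝ) ≤ C * (d * (n : ℝ) ^ (1 + rho α β / (1 - α ^ 2))) ∧ RAM.Stores s' D) ∧
          ∀ (q : Sph d) (E : RAM.Env) (s : RAM.State),
            RAM.Stores s D → (∀ j : Fin d, E.input j = (q : Vec d) j) →
            ∃ (t : ℕ) (s' : RAM.State), RAM.Run E K qry s t s' ∧
              (t : ℝ) ≤ C * (d * (n : ℝ) ^ (rho α β / (1 - α ^ 2))) ∧
              RAM.Stores s' D ∧ s'.real 0 = D.query q) := by
  refine ⟨fun d n α β ε δ hε hδ hδ' => ⟨isProbabilityMeasure_construction n α β hε hδ hδ'.le,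
    construction_isDP n α β hε hδ hδ'.le⟩,
    fun α β hβ0 hβ hα h => construction_accuracy_eventually hβ0 hβ hα h, ?_⟩
  obtain ⟨pre, qry, C, complexity⟩ := RAM.exists_programs
  exact ⟨pre, qry, C, fun d n hd hn α β ε δ hβ0 hβ hα _ _ =>
    complexity d n hd hn α β ε δ hβ0 hβ hα⟩

theorem theorem1 :
    -- privacy
    (∀ (d n : ℕ) (α β ε δ : ℝ), 0 ≤ β → β < α → α < 1 → 0 < ε → 0 < δ → δ < 1 / 2 →
      (∀ S : Multiset (Sph d), IsProbabilityMeasure (construction n α β ε δ S)) ∧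
      IsDP ε δ (fun S : Multiset (Sph d) => construction n α β ε δ S)) ∧
    -- accuracy, as the number of points tends to infinity
    (∀ α β : ℕ → ℝ, (∀ n, 0 ≤ β n) → (∀ n, β n < α n) → (∀ n, α n < 1) →
      (fun n : ℕ => (1 - α n ^ 2) * √(Real.log (Real.log n) / Real.log n))
        =o[atTop] (fun n => α n - β n) →
      (fun n : ℕ => Real.log (Real.log (numFilters n (α n) (β n))) /
          Real.log (numFilters n (α n) (β n)))
        =o[atTop] (fun n => 1 - α n ^ 2) →
      ∃ e₁ e₂ : ℕ → ℝ, Tendsto e₁ atTop (𝓝 0) ∧ Tendsto e₂ atTop (𝓝 0) ∧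
        ∀ ε₀ : ℝ, 0 < ε₀ → ∃ C : ℝ, 0 < C ∧ ∀ᶠ n : ℕ in atTop,
          ∀ (d : ℕ) (ε δ : ℝ), 0 < ε → ε ≤ ε₀ → 0 < δ → δ < 1 / 2 →
          ∀ (S : Multiset (Sph d)) (q : Sph d), S.card = n →
            2 / 3 ≤ construction n (α n) (β n) ε δ S
              {D | (1 - e₁ n) * (ballCount S q (α n) : ℝ)
                      - C * (Real.log (1 / δ) / ε * (n : ℝ) ^ (rho (α n) (β n) + e₂ n))
                    ≤ D.query q ∧
                  D.query q ≤ (ballCount S q (β n) : ℝ)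
                      + C * (Real.log (1 / δ) / ε * (n : ℝ) ^ (rho (α n) (β n) + e₂ n))}) ∧
    -- preprocessing time, space and query time
    (∃ (pre qry : RAM.Prog) (C : ℝ), ∀ (d n : ℕ), 1 ≤ d → 1 ≤ n →
      ∀ α β ε δ : ℝ, 0 ≤ β → β < α → α < 1 → 0 < ε → 0 < δ → δ < 1 / 2 →
      ∃ K : ℕ, (K : ℝ) ≤ C * (d * (n : ℝ) ^ (rho α β / (1 - α ^ 2))) ∧
        ∀ (x : Fin n → Sph d) (g : Fin (numFilters n α β) → Fin d → ℝ)
          (z : Fin (numFilters n α β) → ℝ) (D : Data d (numFilters n α β)),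
          D = build n α β ε δ (Finset.univ.val.map x) g z →
          D.words ≤ K ∧
          (∀ (E : RAM.Env) (s : RAM.State), RAM.Init α β ε δ x g z E s →
            ∃ (t : ℕ) (s' : RAM.State), RAM.Run E K pre s t s' ∧
              (t : ℝ) ≤ C * (d * (n : ℝ) ^ (1 + rho α β / (1 - α ^ 2))) ∧ RAM.Stores s' D) ∧
          ∀ (q : Sph d) (E : RAM.Env) (s : RAM.State),
            RAM.Stores s D → (∀ j : Fin d, E.input j = (q : Vec d) j) →
            ∃ (t : ℕ) (s' : RAM.State), RAM.Run E K qry s t s' ∧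
              (t : ℝ) ≤ C * (d * (n : ℝ) ^ (rho α β / (1 - α ^ 2))) ∧
              RAM.Stores s' D ∧ s'.real 0 = D.query q) :=
  let ⟨privacy, accuracy, pre, qry, C, complexity⟩ := theorem1_general
  ⟨fun d n α β ε δ _ _ _ => privacy d n α β ε δ,
    fun α β hβ0 hβ hα _ => accuracy α β hβ0 (fun n => (hβ n).le) hα,
    pre, qry, C, fun d n hd hn α β ε δ hβ0 hβ hα hε hδ _ =>
      complexity d n hd hn α β ε δ hβ0 hβ.le hα hε hδ⟩
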